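/- Conventions. Let $E$ be an algebra over a commutative ring $R$, graded by $R$-submodules, $E=\bigoplus_{i\in\mathbb Z}E_i$, $E_iE_j\subseteq E_{i+j}$. A graded $E$-module is an $E$-module $V$ with an $R$-module grading $V=\bigoplus_{i\in\mathbb Z}V_i$ such that $E_iV_j\subseteq V_{i+j}$; put $V\langle j\rangle_i:=V_{i-j}$. If $R=F$ is a field, all modules are assumed finite-dimensional, $\mathcal R_0(E)$ is the Grothendieck group of graded $E$-modules, and $\mathcal R_0^+(E)=\{[V]\}\subseteq\mathcal R_0(E)$ is the semigroup of classes of graded modules, on which $\mathbb N[q,q^{-1}]$ acts by $q^j[V]=[V\langle j\rangle]$. A finite-dimensional $F$-algebra $E$ is split if $\operatorname{End}_E(S)=F$ for every simple $E$-module $S$. Setting. Let $A$ be an integral domain with field of fractions $K$, integrally closed in $K$, and let $H=\bigoplus_{i\in\mathbb Z}H_i$ be a $\mathbb Z$-graded associative unital $A$-algebra, finitely generated and free as an $A$-module. For a commutative $A$-algebra $B$ put $BH:=B\otimes_AH$, graded by $BH_i=B\otimes_AH_i$. For a field $F$ that is an $A$-algebra define $$\mathfrak p_F:\mathcal R_0^+(FH)\to\operatorname{Maps}(H_0,F[X]^{\mathbb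 Z}),\qquad \mathfrak p_F([V])(h_0)=\bigl(\text{characteristic polynomial of } 1\otimes h_0 \text{ acting on } V_i\bigr)_{i\in\mathbb Z}.$$ Let $\theta:A\to L$ be a ring homomorphism into a field $L$ such that $L$ is the field of fractions of $\theta(A)$, and let $t_\theta:\operatorname{Maps}(H_0,A[X]^{\mathbb Z})\to\operatorname{Maps}(H_0,L[X]^{\mathbb Z})$ be given by applying $\theta$ to the coefficients. Let $\mathcal O$ be a valuation ring with $A\subseteq\mathcal O\subseteq K$, with field of fractions $K$ and with maximal ideal $J(\mathcal O)$ satisfying $J(\mathcal O)\cap A=\ker\theta$; let $k$ be its residue field, so that $L$ embeds canonically in $k$. Assume that (a) $LH$ is split, or (b) $L=k$ and $L$ is perfect. A graded $\mathcal OH$-lattice is a graded $\mathcal OH$-module that is finitely generated and free over $\mathcal O$; for such a $\widetilde V$ write $K\widetilde V=K\otimes_{\mathcal O}\widetilde V$ and $k\widetilde V=k\otimes_{\mathcal O}\widetilde V$. Theorem. Every element of $\mathcal R_0^+(KH)$ is of the form $[K\widetilde V]$ for some graded $\mathcal OH$-lattice $\widetilde V$, and the map $\mathcal R_0^+(LH)\to\mathcal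 R_0^+(kH)$, $[V]\mapsto[k\otimes_LV]$, is bijective; use it to identify these two semigroups. Then: 1. Setting $d_\theta^{\mathrm{gr}}([K\widetilde V]):=[k\widetilde V]$ for every graded $\mathcal OH$-lattice $\widetilde V$ gives a well-defined homomorphism of $\mathbb N[q,q^{-1}]$-semigroups $d_\theta^{\mathrm{gr}}:\mathcal R_0^+(KH)\to\mathcal R_0^+(LH)$. 2. The image of $\mathfrak p_K$ is contained in $\operatorname{Maps}(H_0,A[X]^{\mathbb Z})$, and $\mathfrak p_L\circ d_\theta^{\mathrm{gr}}=t_\theta\circ\mathfrak p_K$. 3. The map $d_\theta^{\mathrm{gr}}$ is the only map $d:\mathcal R_0^+(KH)\to\mathcal R_0^+(LH)$ with $\mathfrak p_L\circ d=t_\theta\circ\mathfrak p_K$. In particular it does not depend on the choice of $\mathcal O$: every valuation ring $\mathcal O'$ satisfying the same hypotheses (including (a) or (b)) defines the same map. -/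

import Mathlib

open scoped TensorProduct DirectSum LaurentPolynomial

universe u

namespace GrDec

noncomputable section

/-! ## Graded modules -/

section GradedModules

variable {R : Type u} [CommRing R] {H : Type u} [Ring H] [Algebra R H]

/-- A finitely generated graded module over the graded `R`-algebra `H = ⨁ 𝒜 i`: an `R`-module
with a representation `ρ : H → End_R(V)` and an `R`-module grading `V = ⨁ gr j` such that
`(𝒜 i) (gr j) ⊆ gr (i + j)`. Over a field these are the finite-dimensional graded modules. -/
structure GrMod (R : Type u) [CommRing R] {H : Type u} [Ring H] [Algebra R H]
    (𝒜 : ℤ → Submodule R H) where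
  carrier : Type u
  [addCommGroup : AddCommGroup carrier]
  [module : Module R carrier]
  [finite : Module.Finite R carrier]
  /-- the action of `H` -/
  ρ : H →ₐ[R] Module.End R carrier
  /-- the homogeneous components -/
  gr : ℤ → Submodule R carrier
  isInternal : DirectSum.IsInternal gr
  map_mem : ∀ {i j : ℤ} {h : H} {v : carrier}, h ∈ 𝒜 i → v ∈ gr j → ρ h v ∈ gr (i + j)

attribute [instance] GrMod.addCommGroup GrMod.module GrMod.finite

variable {𝒜 : ℤ → Submodule R H}

instance : CoeSort (GrMod R 𝒜) (Type u) := ⟨GrMod.carrier⟩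

namespace GrMod

/-- The shift `V⟨j⟩`, with `V⟨j⟩_i = V_{i - j}`. -/
def shift (j : ℤ) (V : GrMod R 𝒜) : GrMod R 𝒜 where
  carrier := V
  ρ := V.ρ
  gr i := V.gr (i - j)
  isInternal := by
    rw [DirectSum.isInternal_submodule_iff_iSupIndep_and_iSup_eq_top]
    obtain ⟨h1, h2⟩ :=
      (DirectSum.isInternal_submodule_iff_iSupIndep_and_iSup_eq_top _).1 V.isInternal
    exact ⟨h1.comp (sub_left_injective (b := j)),
      ((Equiv.subRight j).iSup_congr fun _ => rfl).trans h2⟩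
  map_mem {i k h v} hh hv := by
    have := V.map_mem hh hv
    rwa [← add_sub_assoc] at this

/-- The direct sum of two graded modules. -/
def prod (V W : GrMod R 𝒜) : GrMod R 𝒜 where
  carrier := V × W
  ρ := AlgHom.ofLinearMap
    { toFun := fun h => (V.ρ h).prodMap (W.ρ h)
      map_add' := fun a b => by ext <;> simp
      map_smul' := fun a b => by ext <;> simp }
    (by ext <;> simp) (fun a b => by ext <;> simp)
  gr i := (V.gr i).prod (W.gr i)
  isInternal := by
    rw [DirectSum.isInternal_submodule_iff_iSupIndep_and_iSup_eq_top]
    obtain ⟨h1, h2⟩ :=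
      (DirectSum.isInternal_submodule_iff_iSupIndep_and_iSup_eq_top _).1 V.isInternal
    obtain ⟨h3, h4⟩ :=
      (DirectSum.isInternal_submodule_iff_iSupIndep_and_iSup_eq_top _).1 W.isInternal
    constructor
    · intro i
      have hle : (⨆ (j) (_ : j ≠ i), (V.gr j).prod (W.gr j)) ≤
          (⨆ (j) (_ : j ≠ i), V.gr j).prod (⨆ (j) (_ : j ≠ i), W.gr j) :=
        iSup₂_le fun j hj => Submodule.prod_mono (le_iSup₂_of_le j hj le_rfl)
          (le_iSup₂_of_le j hj le_rfl)
      rw [Submodule.disjoint_def]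
      rintro ⟨a, b⟩ ⟨ha, hb⟩ hx
      obtain ⟨ha', hb'⟩ := hle hx
      exact Prod.ext (Submodule.disjoint_def.1 (h1 i) a ha ha')
        (Submodule.disjoint_def.1 (h3 i) b hb hb')
    · rw [eq_top_iff]
      rintro ⟨a, b⟩ -
      have hV : (⊤ : Submodule R V).map (LinearMap.inl R V W) ≤
          ⨆ i, (V.gr i).prod (W.gr i) := by
        rw [← h2, Submodule.map_iSup]
        refine iSup_mono fun i => ?_
        rintro _ ⟨x, hx, rfl⟩
        exact ⟨hx, zero_mem _⟩
      have hW : (⊤ : Submodule R W).map (LinearMap.inr R V W) ≤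
          ⨆ i, (V.gr i).prod (W.gr i) := by
        rw [← h4, Submodule.map_iSup]
        refine iSup_mono fun i => ?_
        rintro _ ⟨x, hx, rfl⟩
        exact ⟨zero_mem _, hx⟩
      have := add_mem (hV ⟨a, trivial, rfl⟩) (hW ⟨b, trivial, rfl⟩)
      simpa using this
  map_mem {i j h v} hh hv := ⟨V.map_mem hh hv.1, W.map_mem hh hv.2⟩

/-- The zero graded module. -/
def zero (𝒜 : ℤ → Submodule R H) : GrMod R 𝒜 where
  carrier := PUnit
  ρ := AlgHom.ofLinearMap 0 (Subsingleton.elim _ _) (fun _ _ => Subsingleton.elim _ _)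
  gr _ := ⊥
  isInternal := by
    rw [DirectSum.isInternal_submodule_iff_iSupIndep_and_iSup_eq_top]
    exact ⟨fun _ => disjoint_bot_left, Subsingleton.elim _ _⟩
  map_mem _ _ := (Submodule.mem_bot R).2 (Subsingleton.elim _ _)

/-- A morphism of graded modules: `H`-linear and homogeneous of degree zero. -/
structure IsGradedHom (V W : GrMod R 𝒜) (f : V →ₗ[R] W) : Prop where
  map_action : ∀ (h : H) (v : V), f (V.ρ h v) = W.ρ h (f v)
  map_gr : ∀ (i : ℤ) (v : V), v ∈ V.gr i → f v ∈ W.gr i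

/-- `0 → V₁ → V₂ → V₃ → 0` is a short exact sequence of graded modules. -/
structure IsShortExact (V₁ V₂ V₃ : GrMod R 𝒜) (f : V₁ →ₗ[R] V₂) (g : V₂ →ₗ[R] V₃) : Prop where
  hom_left : IsGradedHom V₁ V₂ f
  hom_right : IsGradedHom V₂ V₃ g
  injective : Function.Injective f
  exact : Function.Exact f g
  surjective : Function.Surjective g

theorem mem_gr_of_map {V W : GrMod R 𝒜} {f : V →ₗ[R] W} (hf : IsGradedHom V W f) (v : V)
    (i : ℤ) (hv : f v ∈ W.gr i) : ∃ v' ∈ V.gr i, f v' = f v ∧ (Function.Injective f → v' = v) := by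
  let _ := V.isInternal.chooseDecomposition
  let _ := W.isInternal.chooseDecomposition
  have key : ∀ v : V, f (DirectSum.decompose V.gr v i) = DirectSum.decompose W.gr (f v) i := by
    intro v
    induction v using DirectSum.Decomposition.inductionOn V.gr with
    | zero => simp
    | @homogeneous j m =>
      have hm := hf.map_gr j m m.2
      by_cases hij : j = i
      · subst hij
        rw [DirectSum.decompose_of_mem_same _ m.2, DirectSum.decompose_of_mem_same _ hm]
      · rw [DirectSum.decompose_of_mem_ne _ m.2 hij, DirectSum.decompose_of_mem_ne _ hm hij,
          map_zero]
    | add a b ha hb => simp [DirectSum.decompose_add, ha, hb]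
  have h := key v
  rw [DirectSum.decompose_of_mem_same _ hv] at h
  exact ⟨_, SetLike.coe_mem _, h, fun hinj => hinj h⟩

end GrMod

/-! ## Grothendieck groups -/

/-- The subgroup of relations `[V₂] = [V₁] + [V₃]` coming from short exact sequences. -/
def relations (𝒜 : ℤ → Submodule R H) : AddSubgroup (FreeAbelianGroup (GrMod R 𝒜)) :=
  AddSubgroup.closure {x | ∃ (V₁ V₂ V₃ : GrMod R 𝒜) (f : V₁ →ₗ[R] V₂) (g : V₂ →ₗ[R] V₃),
    GrMod.IsShortExact V₁ V₂ V₃ f g ∧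
    x = FreeAbelianGroup.of V₂ - FreeAbelianGroup.of V₁ - FreeAbelianGroup.of V₃}

/-- The Grothendieck group `𝓡₀(H)` of finitely generated graded `H`-modules. -/
def R0 (𝒜 : ℤ → Submodule R H) : Type (u + 1) :=
  FreeAbelianGroup (GrMod R 𝒜) ⧸ relations 𝒜

instance (𝒜 : ℤ → Submodule R H) : AddCommGroup (R0 𝒜) :=
  inferInstanceAs (AddCommGroup (FreeAbelianGroup (GrMod R 𝒜) ⧸ relations 𝒜))

/-- The class of a graded module in the Grothendieck group. -/
def cls (V : GrMod R 𝒜) : R0 𝒜 := QuotientAddGroup.mk' (relations 𝒜) (FreeAbelianGroup.of V)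

/-- An invariant of graded modules that is additive on short exact sequences factors through
the Grothendieck group. -/
def R0.lift {G : Type*} [AddCommGroup G] (F : GrMod R 𝒜 → G)
    (hF : ∀ (V₁ V₂ V₃ : GrMod R 𝒜) (f : V₁ →ₗ[R] V₂) (g : V₂ →ₗ[R] V₃),
      GrMod.IsShortExact V₁ V₂ V₃ f g → F V₂ = F V₁ + F V₃) : R0 𝒜 →+ G :=
  QuotientAddGroup.lift (relations 𝒜) (FreeAbelianGroup.lift F) (by
    rw [relations, AddSubgroup.closure_le]
    rintro _ ⟨V₁, V₂, V₃, f, g, h, rfl⟩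
    simp [hF _ _ _ _ _ h])

@[simp] theorem R0.lift_cls {G : Type*} [AddCommGroup G] (F : GrMod R 𝒜 → G) (hF)
    (V : GrMod R 𝒜) : R0.lift F hF (cls V) = F V := by
  change FreeAbelianGroup.lift F (FreeAbelianGroup.of V) = F V
  simp

theorem cls_of_exact {V₁ V₂ V₃ : GrMod R 𝒜} {f : V₁ →ₗ[R] V₂} {g : V₂ →ₗ[R] V₃}
    (h : GrMod.IsShortExact V₁ V₂ V₃ f g) : cls V₂ = cls V₁ + cls V₃ := by
  have : QuotientAddGroup.mk' (relations 𝒜)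
      (FreeAbelianGroup.of V₂ - FreeAbelianGroup.of V₁ - FreeAbelianGroup.of V₃) = 0 :=
    (QuotientAddGroup.eq_zero_iff _).2 (AddSubgroup.subset_closure ⟨_, _, _, f, g, h, rfl⟩)
  rw [map_sub, map_sub, sub_sub, sub_eq_zero] at this
  exact this

theorem cls_prod (V W : GrMod R 𝒜) : cls (V.prod W) = cls V + cls W :=
  cls_of_exact (f := LinearMap.inl R V W) (g := LinearMap.snd R V W)
    { hom_left := ⟨fun h v => by
        change (V.ρ h v, (0 : W)) = (V.ρ h v, W.ρ h 0)
        rw [map_zero], fun i v hv => ⟨hv, zero_mem _⟩⟩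
      hom_right := ⟨fun h v => rfl, fun i v hv => hv.2⟩
      injective := LinearMap.inl_injective
      exact := Function.Exact.inl_snd
      surjective := LinearMap.snd_surjective }

theorem cls_zero : cls (GrMod.zero 𝒜) = 0 := by
  have h : cls (GrMod.zero 𝒜) = cls (GrMod.zero 𝒜) + cls (GrMod.zero 𝒜) :=
    cls_of_exact (f := 0) (g := 0)
      { hom_left := ⟨fun _ _ => rfl, fun _ _ _ => zero_mem _⟩
        hom_right := ⟨fun _ _ => rfl, fun _ _ _ => zero_mem _⟩
        injective := fun _ _ _ => rfl
        exact := fun _ => ⟨fun _ => ⟨0, rfl⟩, fun _ => rfl⟩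
        surjective := fun _ => ⟨0, rfl⟩ }
  simpa using h

/-- `𝓡₀⁺(H)`: the set of the elements `[V]` of `𝓡₀(H)` with `V` a graded `H`-module,
as an additive submonoid of `𝓡₀(H)`. -/
def R0PlusSubmonoid (𝒜 : ℤ → Submodule R H) : AddSubmonoid (R0 𝒜) where
  carrier := Set.range cls
  zero_mem' := ⟨_, cls_zero⟩
  add_mem' := by
    rintro _ _ ⟨V, rfl⟩ ⟨W, rfl⟩
    exact ⟨_, cls_prod V W⟩

/-- The semigroup `𝓡₀⁺(H)`. -/
def R0Plus (𝒜 : ℤ → Submodule R H) : Type (u + 1) := R0PlusSubmonoid 𝒜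

instance (𝒜 : ℤ → Submodule R H) : AddCommMonoid (R0Plus 𝒜) :=
  inferInstanceAs (AddCommMonoid (R0PlusSubmonoid 𝒜))

/-- The class `[V]` of a graded module, as an element of `𝓡₀⁺(H)`. -/
def clsPlus (V : GrMod R 𝒜) : R0Plus 𝒜 := ⟨cls V, V, rfl⟩

theorem clsPlus_surjective : Function.Surjective (clsPlus (𝒜 := 𝒜)) := by
  rintro ⟨_, V, rfl⟩
  exact ⟨V, rfl⟩

theorem clsPlus_eq_iff {V W : GrMod R 𝒜} : clsPlus V = clsPlus W ↔ cls V = cls W :=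
  Subtype.ext_iff

/-- A homomorphism of Grothendieck groups induced by an operation on graded modules, restricted
to the semigroups of classes of graded modules. -/
def R0Plus.map {R' : Type u} [CommRing R'] {H' : Type u} [Ring H'] [Algebra R' H']
    {ℬ : ℤ → Submodule R' H'} (F : GrMod R 𝒜 → GrMod R' ℬ)
    (hF : ∀ (V₁ V₂ V₃ : GrMod R 𝒜) (f : V₁ →ₗ[R] V₂) (g : V₂ →ₗ[R] V₃),
      GrMod.IsShortExact V₁ V₂ V₃ f g → cls (F V₂) = cls (F V₁) + cls (F V₃)) :
    R0Plus 𝒜 →+ R0Plus ℬ where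
  toFun x := ⟨R0.lift (fun V => cls (F V)) hF x.1, by
    obtain ⟨_, V, rfl⟩ := x
    exact ⟨F V, (R0.lift_cls (fun V => cls (F V)) hF V).symm⟩⟩
  map_zero' := Subtype.ext (map_zero _)
  map_add' x y := Subtype.ext (map_add _ x.1 y.1)

@[simp] theorem R0Plus.map_clsPlus {R' : Type u} [CommRing R'] {H' : Type u} [Ring H']
    [Algebra R' H'] {ℬ : ℤ → Submodule R' H'} (F : GrMod R 𝒜 → GrMod R' ℬ) (hF)
    (V : GrMod R 𝒜) : R0Plus.map F hF (clsPlus V) = clsPlus (F V) :=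
  Subtype.ext (R0.lift_cls _ _ V)

/-- The operation `[V] ↦ [V⟨j⟩]` on `𝓡₀⁺(H)`. -/
def shiftHom (𝒜 : ℤ → Submodule R H) (j : ℤ) : AddMonoid.End (R0Plus 𝒜) :=
  R0Plus.map (GrMod.shift j) (fun V₁ V₂ V₃ f g h =>
    cls_of_exact (V₁ := V₁.shift j) (V₂ := V₂.shift j) (V₃ := V₃.shift j) (f := f) (g := g)
      { hom_left := ⟨h.hom_left.map_action, fun i v hv => h.hom_left.map_gr (i - j) v hv⟩
        hom_right := ⟨h.hom_right.map_action, fun i v hv => h.hom_right.map_gr (i - j) v hv⟩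
        injective := h.injective
        exact := h.exact
        surjective := h.surjective })

@[simp] theorem shiftHom_clsPlus (j : ℤ) (V : GrMod R 𝒜) :
    shiftHom 𝒜 j (clsPlus V) = clsPlus (V.shift j) := R0Plus.map_clsPlus _ _ V

theorem shift_eq {V : GrMod R 𝒜} {g : ℤ → Submodule R V} (h : g = V.gr) (h1 h2) :
    (⟨V, V.ρ, g, h1, h2⟩ : GrMod R 𝒜) = V := by
  subst h
  rfl

/-- The monoid homomorphism `j ↦ ([V] ↦ [V⟨j⟩])`. -/
def shiftMonoidHom (𝒜 : ℤ → Submodule R H) : Multiplicative ℤ →* AddMonoid.End (R0Plus 𝒜) where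
  toFun j := shiftHom 𝒜 j.toAdd
  map_one' := by
    ext x
    obtain ⟨V, rfl⟩ := clsPlus_surjective x
    rw [shiftHom_clsPlus]
    exact congrArg clsPlus (shift_eq (V := V) (by funext i; simp) _ _)
  map_mul' i j := by
    ext x
    obtain ⟨V, rfl⟩ := clsPlus_surjective x
    change _ = shiftHom 𝒜 i.toAdd (shiftHom 𝒜 j.toAdd (clsPlus V))
    simp only [shiftHom_clsPlus]
    refine congrArg clsPlus ?_
    have : ∀ g : ℤ → Submodule R V, g = (fun k => V.gr (k - (i * j).toAdd)) → ∀ h1 h2,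
        (V.shift (i * j).toAdd : GrMod R 𝒜) = ⟨V, V.ρ, g, h1, h2⟩ := by
      rintro g rfl h1 h2
      rfl
    refine this (fun k => V.gr (k - i.toAdd - j.toAdd)) ?_ _ _
    funext k
    rw [toAdd_mul, sub_sub]

/-- The action of `ℕ[q, q⁻¹]` on `𝓡₀⁺(H)`, determined by `q ^ j [V] = [V⟨j⟩]`. -/
instance (𝒜 : ℤ → Submodule R H) : Module ℕ[T;T⁻¹] (R0Plus 𝒜) :=
  Module.compHom (R0Plus 𝒜)
    (AddMonoidAlgebra.lift ℕ (AddMonoid.End (R0Plus 𝒜)) ℤ (shiftMonoidHom 𝒜)).toRingHom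

theorem T_smul_clsPlus (j : ℤ) (V : GrMod R 𝒜) :
    (LaurentPolynomial.T j : ℕ[T;T⁻¹]) • clsPlus V = clsPlus (V.shift j) := by
  change AddMonoidAlgebra.lift ℕ (AddMonoid.End (R0Plus 𝒜)) ℤ (shiftMonoidHom 𝒜)
    (LaurentPolynomial.T j) (clsPlus V) = _
  rw [LaurentPolynomial.T, AddMonoidAlgebra.lift_single, one_smul]
  exact shiftHom_clsPlus j V

end GradedModules

/-! ## Graded characteristic polynomials -/

section Charpoly

theorem charpoly_of_exact {F V₁ V₂ V₃ : Type*} [Field F] [AddCommGroup V₁] [Module F V₁]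
    [AddCommGroup V₂] [Module F V₂] [AddCommGroup V₃] [Module F V₃] [Module.Finite F V₁]
    [Module.Finite F V₂] [Module.Finite F V₃] (f : V₁ →ₗ[F] V₂) (g : V₂ →ₗ[F] V₃)
    (hf : Function.Injective f) (hfg : Function.Exact f g) (hg : Function.Surjective g)
    (a₁ : V₁ →ₗ[F] V₁) (a₂ : V₂ →ₗ[F] V₂) (a₃ : V₃ →ₗ[F] V₃)
    (h₁ : ∀ v, f (a₁ v) = a₂ (f v)) (h₂ : ∀ v, g (a₂ v) = a₃ (g v)) :
    a₂.charpoly = a₁.charpoly * a₃.charpoly := by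
  obtain ⟨s, hs⟩ := g.exists_rightInverse_of_surjective (LinearMap.range_eq_top.2 hg)
  obtain ⟨e, he₁, he₂⟩ := hfg.splitSurjectiveEquiv hf ⟨s, hs⟩
  have e₁ : ∀ v, e (f v) = (v, 0) := fun v => by
    rw [he₁]
    simp
  have e₂ : ∀ v, (e v).2 = g v := fun v => by
    rw [he₂]
    simp
  let b₁ := Module.Free.chooseBasis F V₁
  let b₃ := Module.Free.chooseBasis F V₃
  rw [← LinearEquiv.charpoly_conj e a₂, ← LinearMap.charpoly_toMatrix a₁ b₁,
    ← LinearMap.charpoly_toMatrix a₃ b₃, ← LinearMap.charpoly_toMatrix _ (b₁.prod b₃)]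
  have hc₁ : ∀ v, e.conj a₂ (v, 0) = (a₁ v, 0) := fun v => by
    rw [LinearEquiv.conj_apply_apply, ← e₁, e.symm_apply_apply, ← h₁, e₁]
  have hc₂ : ∀ x, (e (a₂ (e.symm x))).2 = a₃ x.2 := fun x => by
    rw [e₂, h₂, ← e₂, e.apply_symm_apply]
  rw [← Matrix.charpoly_fromBlocks_zero₂₁ (M₁₂ := Matrix.of fun i j =>
    b₁.repr (e.conj a₂ (0, b₃ j)).1 i)]
  congr 1
  ext i j
  rcases i with i | i <;> rcases j with j | j <;>
    simp [LinearMap.toMatrix_apply, hc₁, hc₂]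

variable {F : Type u} [Field F] {H : Type u} [Ring H] [Algebra F H] {𝒜 : ℤ → Submodule F H}

/-- The representation `ρ_{V_i}` of `H₀ = 𝒜 0` on the homogeneous component `V_i`. -/
def GrMod.ρDeg (V : GrMod F 𝒜) (i : ℤ) (h : 𝒜 0) : V.gr i →ₗ[F] V.gr i :=
  (V.ρ (h : H)).restrict fun v hv => by
    have := V.map_mem h.2 hv
    rwa [zero_add] at this

/-- The family `(Poly (ρ_{V_i}(h)))_{i ∈ ℤ}` of characteristic polynomials, for `h ∈ H₀`. -/
def GrMod.poly (V : GrMod F 𝒜) (h : 𝒜 0) (i : ℤ) : Polynomial F := (V.ρDeg i h).charpoly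

theorem GrMod.poly_of_exact {V₁ V₂ V₃ : GrMod F 𝒜} {f : V₁ →ₗ[F] V₂} {g : V₂ →ₗ[F] V₃}
    (hfg : GrMod.IsShortExact V₁ V₂ V₃ f g) (h : 𝒜 0) (i : ℤ) :
    V₂.poly h i = V₁.poly h i * V₃.poly h i := by
  refine charpoly_of_exact (f.restrict (hfg.hom_left.map_gr i))
    (g.restrict (hfg.hom_right.map_gr i)) ?_ ?_ ?_ _ _ _ ?_ ?_
  · intro a b hab
    exact Subtype.ext (hfg.injective (congrArg Subtype.val hab))
  · intro v
    constructor
    · intro hv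
      obtain ⟨w, hw⟩ := (hfg.exact v).1 (congrArg Subtype.val hv)
      obtain ⟨w', hw', hw'', -⟩ := mem_gr_of_map hfg.hom_left w i (hw ▸ v.2)
      exact ⟨⟨w', hw'⟩, Subtype.ext (hw''.trans hw)⟩
    · rintro ⟨w, rfl⟩
      exact Subtype.ext ((hfg.exact _).2 ⟨w, rfl⟩)
  · intro v
    obtain ⟨w, hw⟩ := hfg.surjective v
    obtain ⟨w', hw', hw'', -⟩ := mem_gr_of_map hfg.hom_right w i (hw ▸ v.2)
    exact ⟨⟨w', hw'⟩, Subtype.ext (hw''.trans hw)⟩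
  · intro v
    exact Subtype.ext (hfg.hom_left.map_action h v)
  · intro v
    exact Subtype.ext (hfg.hom_right.map_action h v)

theorem GrMod.poly_eq_of_cls_eq {V W : GrMod F 𝒜} (hVW : cls V = cls W) :
    V.poly = W.poly := by
  funext h i
  have hne : ∀ V : GrMod F 𝒜, algebraMap (Polynomial F) (RatFunc F) (V.poly h i) ≠ 0 := fun V => by
    rw [Ne, FaithfulSMul.algebraMap_eq_zero_iff]
    exact (LinearMap.charpoly_monic _).ne_zero
  let Φ : R0 𝒜 →+ Additive (RatFunc F)ˣ :=
    R0.lift (fun V => Additive.ofMul (Units.mk0 _ (hne V))) (fun V₁ V₂ V₃ f g hfg => by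
      rw [← ofMul_mul]
      congr 1
      ext
      simp [GrMod.poly_of_exact hfg h i])
  have := congrArg Φ hVW
  simp only [Φ, R0.lift_cls] at this
  have h2 := congrArg Units.val (Additive.ofMul.injective this)
  exact FaithfulSMul.algebraMap_injective _ _ h2

/-- The map `𝔭_F : 𝓡₀⁺(H) → Maps(H₀, F[X]^ℤ)`, `[V] ↦ (h ↦ (Poly (ρ_{V_i}(h)))_i)`. -/
def polyMap (x : R0Plus 𝒜) : 𝒜 0 → ℤ → Polynomial F := (Classical.choose x.2).poly

theorem polyMap_clsPlus (V : GrMod F 𝒜) : polyMap (clsPlus V) = V.poly :=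
  GrMod.poly_eq_of_cls_eq (Classical.choose_spec (clsPlus V).2)

end Charpoly

/-! ## Extension of scalars -/

section BaseChange

variable {A H : Type u} [CommRing A] [Ring H] [Algebra A H]

/-- The grading `BH = ⨁ BH_i` of `BH = B ⊗_A H`. -/
abbrev grBC (B : Type u) [CommRing B] [Algebra A B] (𝒜 : ℤ → Submodule A H) :
    ℤ → Submodule B (B ⊗[A] H) := fun i => (𝒜 i).baseChange B

variable {B : Type u} [CommRing B] [Algebra A B] {𝒜 : ℤ → Submodule A H}

/-- For `A → B → C` and a representation `ρ` of `BH` on `V`, the representation of `CH` on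
`C ⊗_B V` in which `1 ⊗ h` acts as `id ⊗ ρ(1 ⊗ h)`. -/
def extendRep (C : Type u) [CommRing C] [Algebra A C] [Algebra B C] [IsScalarTower A B C]
    {V : Type u} [AddCommGroup V] [Module B V] (ρ : B ⊗[A] H →ₐ[B] Module.End B V) :
    C ⊗[A] H →ₐ[C] Module.End C (C ⊗[B] V) :=
  AlgHom.liftEquiv A C H (Module.End C (C ⊗[B] V))
    ((((Module.End.baseChangeHom B C V).comp ρ).restrictScalars A).comp
      Algebra.TensorProduct.includeRight)

theorem extendRep_tmul_tmul (C : Type u) [CommRing C] [Algebra A C] [Algebra B C]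
    [IsScalarTower A B C] {V : Type u} [AddCommGroup V] [Module B V]
    (ρ : B ⊗[A] H →ₐ[B] Module.End B V) (c d : C) (h : H) (v : V) :
    extendRep C ρ (c ⊗ₜ h) (d ⊗ₜ v) = (c * d) ⊗ₜ ρ (1 ⊗ₜ h) v := by
  change (c • (ρ (1 ⊗ₜ h)).baseChange C) (d ⊗ₜ v) = _
  simp [TensorProduct.smul_tmul']

/-- For `A → B → C` and a graded `BH`-module `V`, the graded `CH`-module `C ⊗_B V`, on which
`1 ⊗ h` acts as `id ⊗ ρ(1 ⊗ h)`, with homogeneous components `C ⊗_B V_i`. -/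
def GrMod.extend (C : Type u) [CommRing C] [Algebra A C] [Algebra B C] [IsScalarTower A B C]
    (V : GrMod B (grBC B 𝒜)) : GrMod C (grBC C 𝒜) where
  carrier := C ⊗[B] V
  ρ := extendRep C V.ρ
  gr i := (V.gr i).baseChange C
  isInternal := DirectSum.IsInternal.baseChange _ V.isInternal
  map_mem {i j h v} hh hv := by
    obtain ⟨x, rfl⟩ := hh
    obtain ⟨y, rfl⟩ := hv
    induction x with
    | zero => simp
    | add a b ha hb =>
      rw [map_add, map_add, LinearMap.add_apply]
      exact add_mem ha hb
    | tmul c h =>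
      induction y with
      | zero => simp
      | add a b ha hb =>
        rw [map_add, map_add]
        exact add_mem ha hb
      | tmul d v =>
        rw [LinearMap.baseChange_tmul, LinearMap.baseChange_tmul, extendRep_tmul_tmul]
        exact Submodule.tmul_mem_baseChange_of_mem _
          (V.map_mem (Submodule.tmul_mem_baseChange_of_mem (1 : B) h.2) v.2)

theorem extendRep_comm (C : Type u) [CommRing C] [Algebra A C] [Algebra B C]
    [IsScalarTower A B C] {V W : Type u} [AddCommGroup V] [Module B V] [AddCommGroup W]
    [Module B W] (ρ : B ⊗[A] H →ₐ[B] Module.End B V) (σ : B ⊗[A] H →ₐ[B] Module.End B W)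
    (f : V →ₗ[B] W) (hf : ∀ h v, f (ρ h v) = σ h (f v)) (x : C ⊗[A] H) (v : C ⊗[B] V) :
    f.baseChange C (extendRep C ρ x v) = extendRep C σ x (f.baseChange C v) := by
  induction x with
  | zero => simp
  | add a b ha hb => rw [map_add, map_add, LinearMap.add_apply, LinearMap.add_apply, map_add,
      ha, hb]
  | tmul c h =>
    induction v with
    | zero => simp
    | add a b ha hb => rw [map_add, map_add, map_add, map_add, ha, hb]
    | tmul d v => simp only [extendRep_tmul_tmul, LinearMap.baseChange_tmul, hf]

theorem baseChange_mem (C : Type u) [CommRing C] [Algebra B C] {V W : Type u} [AddCommGroup V]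
    [Module B V] [AddCommGroup W] [Module B W] (f : V →ₗ[B] W) (p : Submodule B V)
    (q : Submodule B W) (hf : ∀ v ∈ p, f v ∈ q) (v : C ⊗[B] V) (hv : v ∈ p.baseChange C) :
    f.baseChange C v ∈ q.baseChange C := by
  obtain ⟨v, rfl⟩ := hv
  induction v with
  | zero => simp
  | add a b ha hb =>
    rw [map_add, map_add]
    exact add_mem ha hb
  | tmul d v => exact Submodule.tmul_mem_baseChange_of_mem d (hf v v.2)

theorem GrMod.IsGradedHom.extend (C : Type u) [CommRing C] [Algebra A C] [Algebra B C]
    [IsScalarTower A B C] {V W : GrMod B (grBC B 𝒜)} {f : V →ₗ[B] W}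
    (hf : GrMod.IsGradedHom V W f) :
    GrMod.IsGradedHom (V.extend C) (W.extend C) (f.baseChange C) where
  map_action := extendRep_comm C V.ρ W.ρ f hf.map_action
  map_gr i := baseChange_mem C f (V.gr i) (W.gr i) (hf.map_gr i)

/-- The map `d_B^C : 𝓡₀⁺(BH) → 𝓡₀⁺(CH)`, `[V] ↦ [C ⊗_B V]`, for a field extension `C / B`. -/
def extendPlus (𝒜 : ℤ → Submodule A H) (B : Type u) [Field B] [Algebra A B] (C : Type u)
    [Field C] [Algebra A C] [Algebra B C] [IsScalarTower A B C] :
    R0Plus (grBC B 𝒜) →+ R0Plus (grBC C 𝒜) :=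
  R0Plus.map (GrMod.extend C) (fun _ _ _ f g h =>
    cls_of_exact (f := f.baseChange C) (g := g.baseChange C)
      { hom_left := h.hom_left.extend C
        hom_right := h.hom_right.extend C
        injective := Module.Flat.lTensor_preserves_injective_linearMap (M := C) f h.injective
        exact := lTensor_exact C h.exact h.surjective
        surjective := LinearMap.lTensor_surjective C h.surjective })

/-- The map `𝔭_B : 𝓡₀⁺(BH) → Maps(H₀, B[X]^ℤ)` for `B` a field, where `H₀ = 𝒜 0` acts on
`BH`-modules through `h ↦ 1 ⊗ h`. -/
def polyMapBC (𝒜 : ℤ → Submodule A H) (B : Type u) [Field B] [Algebra A B]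
    (x : R0Plus (grBC B 𝒜)) : 𝒜 0 → ℤ → Polynomial B :=
  fun h => polyMap x ⟨1 ⊗ₜ (h : H), Submodule.tmul_mem_baseChange_of_mem 1 h.2⟩

/-- The map `t_θ : Maps(H₀, A[X]^ℤ) → Maps(H₀, L[X]^ℤ)` applying `θ : A → L`
(the structure map of the `A`-algebra `L`) to the coefficients. -/
def coeffMap (A L : Type*) [CommRing A] [CommRing L] [Algebra A L] {M : Type*}
    (ψ : M → ℤ → Polynomial A) : M → ℤ → Polynomial L :=
  fun h i => (ψ h i).map (algebraMap A L)

end BaseChange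

/-! ## Split algebras -/

/-- The finite-dimensional `F`-algebra `E` is split: the only endomorphisms of a simple
`E`-module are the scalars in `F`. -/
def IsSplit (F E : Type u) [Field F] [Ring E] [Algebra F E] : Prop :=
  ∀ (S : Type u) [AddCommGroup S] [Module F S] [Module E S] [IsScalarTower F E S]
    [IsSimpleModule E S] (f : S →ₗ[E] S), ∃ c : F, ∀ s : S, f s = c • s

/-! ## Valuation rings adapted to a specialization -/

section Specialization

/-- A valuation ring `O` with `A ⊆ O ⊆ K` and `J(O) ∩ A = ker θ`, where `θ : A → L` is the
structure map of the `A`-algebra `L`. -/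
structure SpecValRing (A K L : Type u) [CommRing A] [Field K] [Algebra A K] [Field L]
    [Algebra A L] where
  O : ValuationSubring K
  le : ∀ a : A, algebraMap A K a ∈ O
  center : ∀ a : A, (⟨algebraMap A K a, le a⟩ : O) ∈ IsLocalRing.maximalIdeal O ↔
    algebraMap A L a = 0

namespace SpecValRing

variable {A K L : Type u} [CommRing A] [Field K] [Algebra A K] [Field L] [Algebra A L]

instance (S : SpecValRing A K L) : Algebra A S.O :=
  ((algebraMap A K).codRestrict S.O S.le).toAlgebra

instance (S : SpecValRing A K L) : IsScalarTower A S.O K :=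
  IsScalarTower.of_algebraMap_eq fun _ => rfl

/-- The residue field of `O`. -/
abbrev k (S : SpecValRing A K L) : Type u := IsLocalRing.ResidueField S.O

theorem algebraMap_k_eq_zero_iff (S : SpecValRing A K L) (a : A) :
    algebraMap A S.k a = 0 ↔ algebraMap A L a = 0 := by
  rw [IsScalarTower.algebraMap_apply A S.O S.k, ← S.center a]
  exact IsLocalRing.residue_eq_zero_iff (R := S.O) _

/-- The embedding of `θ(A) ≅ A / ker θ` into the residue field. -/
def rangeToResidue (S : SpecValRing A K L) : (algebraMap A L).range →+* S.k :=
  (Ideal.Quotient.lift (RingHom.ker (algebraMap A L)) (algebraMap A S.k)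
    fun a ha => (S.algebraMap_k_eq_zero_iff a).2 ha).comp
    (algebraMap A L).quotientKerEquivRange.symm.toRingHom

theorem rangeToResidue_apply (S : SpecValRing A K L) (a : A) :
    S.rangeToResidue ((algebraMap A L).rangeRestrict a) = algebraMap A S.k a := by
  have : (algebraMap A L).quotientKerEquivRange.symm ((algebraMap A L).rangeRestrict a) =
      Ideal.Quotient.mk _ a := by
    rw [RingEquiv.symm_apply_eq]
    rfl
  change Ideal.Quotient.lift (RingHom.ker (algebraMap A L)) (algebraMap A S.k)
    (fun a ha => (S.algebraMap_k_eq_zero_iff a).2 ha)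
    ((algebraMap A L).quotientKerEquivRange.symm ((algebraMap A L).rangeRestrict a)) = _
  rw [this, Ideal.Quotient.lift_mk]

theorem rangeToResidue_injective (S : SpecValRing A K L) :
    Function.Injective S.rangeToResidue := by
  rw [injective_iff_map_eq_zero]
  intro x hx
  obtain ⟨a, rfl⟩ := (algebraMap A L).rangeRestrict_surjective x
  rw [rangeToResidue_apply, algebraMap_k_eq_zero_iff] at hx
  exact Subtype.ext hx

variable [IsFractionRing (algebraMap A L).range L]

/-- `L`, the field of fractions of `θ(A)`, regarded as a subfield of the residue field `k`. -/
instance (S : SpecValRing A K L) : Algebra L S.k :=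
  (IsFractionRing.lift S.rangeToResidue_injective).toAlgebra

instance (S : SpecValRing A K L) : IsScalarTower A L S.k :=
  IsScalarTower.of_algebraMap_eq fun a => by
    rw [← S.rangeToResidue_apply]
    exact (IsFractionRing.lift_algebraMap S.rangeToResidue_injective
      ((algebraMap A L).rangeRestrict a)).symm

/-- `LH` is split, or `L = k` and `L` is perfect. -/
def SplitOrPerfect (H : Type u) [Ring H] [Algebra A H] (S : SpecValRing A K L) : Prop :=
  IsSplit L (L ⊗[A] H) ∨ (Function.Bijective (algebraMap L S.k) ∧ PerfectField L)

/-- The map `d` is given by modular reduction through `O`: for every graded `OH`-lattice `V`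
(a graded `OH`-module that is finitely generated and free over `O`),
`d [K ⊗_O V] = [k ⊗_O V]`, where `𝓡₀⁺(LH)` is compared with `𝓡₀⁺(kH)` by means of `d_L^k`. -/
def IsModularReduction {H : Type u} [Ring H] [Algebra A H] {𝒜 : ℤ → Submodule A H} (S : SpecValRing A K L)
    (d : R0Plus (grBC K 𝒜) → R0Plus (grBC L 𝒜)) : Prop :=
  ∀ V : GrMod S.O (grBC S.O 𝒜), Module.Free S.O V →
    extendPlus 𝒜 L S.k (d (clsPlus (V.extend K))) = clsPlus (V.extend S.k)

end SpecValRing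

end Specialization

end

end GrDec

namespace GrDec

noncomputable section

/-! ## Graded submodules and graded simple modules -/

/-! The whole theorem rests on the injectivity of `𝔭_L`. Take simple graded modules `T₁, …, Tₙ`,
none in the class of a simple `S`, and a nonzero `s ∈ S_i`. Some `e` of degree zero kills every
`(T_r)_i` and fixes `s` (`exists_separating_list`), so `1` is a root of the characteristic
polynomial of `e` on `S_i`, but not on any `(T_r)_i`. Hence equal families of polynomials force a
common simple constituent, which can be cancelled because the polynomials are monic
(`list_sum_clsPlus_eq`). Since `L` is the field of fractions of `θ(A)`, a nonzero multiple of each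
`e` comes from `H₀`, and the elements of `H₀` suffice (`polyMapBC_injective`).

On a lattice over `O`, the characteristic polynomials over `K` and over `k` are both images of one
polynomial over `O`. Over `K` they have coefficients in `A`, by integrality and Gauss's lemma
(`exists_coeffMap_eq_polyMapBC`), so the family over `k` is obtained from the one over `K` by
reducing coefficients (`polyMapBC_residue`). Lattices exist because finitely generated torsion-free
modules over a valuation ring are free (`exists_lattice`).

To descend from `k` to `L`, `[V] ↦ [k ⊗ V]` must be bijective. Injectivity is again that of `𝔭_L`.
Surjectivity holds once simple graded modules stay simple over `k` (`extendPlus_surjective`): this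
is clear if `L = k`; in the split case `LH` acts on a simple graded module through its full
endomorphism algebra, by density.

Modular reduction is therefore equivalent to `𝔭_L ∘ d = t_θ ∘ 𝔭_K` (`isModularReduction_iff`).
Existence comes from lattices; additivity, compatibility with shifts, uniqueness and independence of
`O` all come from the injectivity of `𝔭_L`. -/

theorem isInternal_of_proj {R M : Type*} [CommRing R] [AddCommGroup M] [Module R M]
    {g : ℤ → Submodule R M} (P : ℤ → M →ₗ[R] M) (hP : ∀ i, ∀ x ∈ g i, P i x = x)
    (hP' : ∀ i j, j ≠ i → ∀ x ∈ g j, P i x = 0) (hg : ⨆ i, g i = ⊤) :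
    DirectSum.IsInternal g := by
  rw [DirectSum.isInternal_submodule_iff_iSupIndep_and_iSup_eq_top]
  refine ⟨fun i => ?_, hg⟩
  rw [Submodule.disjoint_def]
  intro x hx hx'
  have : (⨆ (j) (_ : j ≠ i), g j) ≤ LinearMap.ker (P i) :=
    iSup₂_le fun j hj y hy => hP' i j hj y hy
  rw [← hP i x hx]
  exact this hx'

namespace GrMod

section Proj

variable {R : Type u} [CommRing R] {H : Type u} [Ring H] [Algebra R H] {𝒜 : ℤ → Submodule R H}

/-- The projection of a graded module onto its component of degree `i`. -/
def proj (V : GrMod R 𝒜) (i : ℤ) : V →ₗ[R] V :=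
  letI := V.isInternal.chooseDecomposition
  (V.gr i).subtype ∘ₗ DirectSum.component R ℤ (fun i => V.gr i) i ∘ₗ
    (DirectSum.decomposeLinearEquiv V.gr).toLinearMap

variable (V : GrMod R 𝒜)

theorem proj_mem (i : ℤ) (v : V) : V.proj i v ∈ V.gr i := SetLike.coe_mem _

variable {V} in
theorem proj_of_mem {i : ℤ} {v : V} (hv : v ∈ V.gr i) : V.proj i v = v :=
  letI := V.isInternal.chooseDecomposition
  DirectSum.decompose_of_mem_same V.gr hv

variable {V} in
theorem proj_of_mem_ne {i j : ℤ} {v : V} (hv : v ∈ V.gr j) (hij : j ≠ i) : V.proj i v = 0 :=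
  letI := V.isInternal.chooseDecomposition
  DirectSum.decompose_of_mem_ne V.gr hv hij

theorem exists_sum_proj (v : V) : ∃ s : Finset ℤ, ∑ i ∈ s, V.proj i v = v := by
  classical
  let _ := V.isInternal.chooseDecomposition
  exact ⟨_, DirectSum.sum_support_decompose V.gr v⟩

variable {V} in
theorem mem_of_proj_mem {p : Submodule R V} {v : V} (h : ∀ i, V.proj i v ∈ p) : v ∈ p := by
  obtain ⟨s, hs⟩ := V.exists_sum_proj v
  rw [← hs]
  exact sum_mem fun i _ => h i

theorem iSup_gr : ⨆ i, V.gr i = ⊤ :=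
  ((DirectSum.isInternal_submodule_iff_iSupIndep_and_iSup_eq_top _).1 V.isInternal).2

variable {V} in
theorem ext_gr {M : Type*} [AddCommGroup M] [Module R M] {f g : V →ₗ[R] M}
    (h : ∀ i, ∀ v ∈ V.gr i, f v = g v) : f = g := by
  have : (⨆ i, V.gr i) ≤ LinearMap.eqLocus f g := iSup_le fun i v hv => h i v hv
  rw [iSup_gr] at this
  exact LinearMap.ext fun v => this trivial

theorem algebra_mem_of_homogeneous [GradedAlgebra 𝒜] {p : Submodule R H}
    (hp : ∀ i, 𝒜 i ≤ p) (h : H) : h ∈ p := by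
  have := iSup_le hp
  rw [((DirectSum.isInternal_submodule_iff_iSupIndep_and_iSup_eq_top _).1
    (DirectSum.Decomposition.isInternal 𝒜)).2] at this
  exact this trivial

variable {V} in
theorem IsGradedHom.map_proj {W : GrMod R 𝒜} {f : V →ₗ[R] W} (hf : IsGradedHom V W f) (i : ℤ)
    (v : V) : f (V.proj i v) = W.proj i (f v) := by
  refine LinearMap.congr_fun (f := f ∘ₗ V.proj i) (g := W.proj i ∘ₗ f) (ext_gr fun j w hw => ?_) v
  have := hf.map_gr j w hw
  rcases eq_or_ne j i with rfl | hij
  · simp [proj_of_mem hw, proj_of_mem this]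
  · simp [proj_of_mem_ne hw hij, proj_of_mem_ne this hij]

theorem ρ_mul (g h : H) (v : V) : V.ρ (g * h) v = V.ρ g (V.ρ h v) := by
  rw [map_mul, Module.End.mul_apply]

theorem ρ_one (v : V) : V.ρ 1 v = v := by
  rw [map_one, Module.End.one_apply]

/-- A graded submodule: stable under the action of `H` and under the projections onto the
homogeneous components. -/
structure IsGrSub (p : Submodule R V) : Prop where
  act : ∀ (h : H) (v : V), v ∈ p → V.ρ h v ∈ p
  proj : ∀ (i : ℤ) (v : V), v ∈ p → V.proj i v ∈ p

variable {V}

theorem IsGradedHom.isGrSub_ker {W : GrMod R 𝒜} {f : V →ₗ[R] W} (hf : IsGradedHom V W f) :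
    V.IsGrSub (LinearMap.ker f) where
  act h v hv := by
    rw [LinearMap.mem_ker] at hv ⊢
    rw [hf.map_action, hv, map_zero]
  proj i v hv := by
    rw [LinearMap.mem_ker] at hv ⊢
    rw [hf.map_proj, hv, map_zero]

theorem IsGradedHom.isGrSub_range {W : GrMod R 𝒜} {f : V →ₗ[R] W} (hf : IsGradedHom V W f) :
    W.IsGrSub (LinearMap.range f) where
  act h v hv := by
    obtain ⟨w, rfl⟩ := hv
    exact ⟨_, hf.map_action h w⟩
  proj i v hv := by
    obtain ⟨w, rfl⟩ := hv
    exact ⟨_, hf.map_proj i w⟩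

theorem proj_mem_of_mem_iSup {q : ℤ → Submodule R V} (hq : ∀ i, q i ≤ V.gr i) {v : V}
    (hv : v ∈ ⨆ i, q i) (i : ℤ) : V.proj i v ∈ q i := by
  have : (⨆ i, q i) ≤ (q i).comap (V.proj i) := iSup_le fun j w hw => by
    rw [Submodule.mem_comap]
    rcases eq_or_ne j i with rfl | hij
    · rwa [proj_of_mem (hq _ hw)]
    · rw [proj_of_mem_ne (hq _ hw) hij]
      exact zero_mem _
  exact this hv

theorem isGrSub_iSup [GradedAlgebra 𝒜] {q : ℤ → Submodule R V} (hq : ∀ i, q i ≤ V.gr i)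
    (hact : ∀ (i j : ℤ) (h : H) (v : V), h ∈ 𝒜 i → v ∈ q j → V.ρ h v ∈ q (i + j)) :
    V.IsGrSub (⨆ i, q i) where
  act h v hv := by
    have : (⨆ i, q i) ≤ (⨆ i, q i).comap (V.ρ h) := iSup_le fun j w hw => by
      have key : ∀ h : H, h ∈ (⨆ i, q i).comap (V.ρ.toLinearMap.flip w) :=
        algebra_mem_of_homogeneous fun i h hh =>
          Submodule.mem_iSup_of_mem (i + j) (hact i j h w hh hw)
      exact key h
    exact this hv
  proj i v hv := Submodule.mem_iSup_of_mem i (proj_mem_of_mem_iSup hq hv i)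

/-- A graded module is simple if it is nonzero and has no nontrivial graded submodules. -/
structure IsSimple (V : GrMod R 𝒜) : Prop where
  nontrivial : Nontrivial V
  eq_bot_or_eq_top : ∀ p : Submodule R V, V.IsGrSub p → p = ⊥ ∨ p = ⊤

theorem IsSimple.exists_gr_ne_zero (hV : V.IsSimple) : ∃ i, ∃ v ∈ V.gr i, v ≠ 0 := by
  obtain ⟨v, hv⟩ := @exists_ne _ hV.nontrivial (0 : V)
  by_contra! hc
  exact hv ((Submodule.mem_bot R).1 (mem_of_proj_mem fun i => hc i _ (V.proj_mem i v)))

theorem IsSimple.injective (hV : V.IsSimple) {W : GrMod R 𝒜} {f : V →ₗ[R] W}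
    (hf : IsGradedHom V W f) (h0 : f ≠ 0) : Function.Injective f := by
  rw [← LinearMap.ker_eq_bot]
  refine (hV.eq_bot_or_eq_top _ hf.isGrSub_ker).resolve_right fun h => h0 ?_
  exact LinearMap.ker_eq_top.1 h

theorem IsSimple.surjective {W : GrMod R 𝒜} (hW : W.IsSimple) {f : V →ₗ[R] W}
    (hf : IsGradedHom V W f) (h0 : f ≠ 0) : Function.Surjective f := by
  rw [← LinearMap.range_eq_top]
  refine (hW.eq_bot_or_eq_top _ hf.isGrSub_range).resolve_left fun h => h0 ?_
  exact LinearMap.range_eq_bot.1 h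

theorem cls_eq_of_bijective {W : GrMod R 𝒜} {f : V →ₗ[R] W} (hf : IsGradedHom V W f)
    (hb : Function.Bijective f) : cls V = cls W := by
  have := cls_of_exact (V₁ := V) (V₂ := W) (V₃ := zero 𝒜) (f := f) (g := 0)
    { hom_left := hf
      hom_right := ⟨fun _ _ => rfl, fun _ _ _ => zero_mem _⟩
      injective := hb.1
      exact := fun w => ⟨fun _ => hb.2 w, fun _ => rfl⟩
      surjective := fun _ => ⟨0, rfl⟩ }
  rw [this, cls_zero, add_zero]

theorem clsPlus_eq_of_bijective {W : GrMod R 𝒜} {f : V →ₗ[R] W} (hf : IsGradedHom V W f)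
    (hb : Function.Bijective f) : clsPlus V = clsPlus W :=
  clsPlus_eq_iff.2 (cls_eq_of_bijective hf hb)

theorem IsShortExact.clsPlus_eq {V₁ V₂ V₃ : GrMod R 𝒜} {f : V₁ →ₗ[R] V₂} {g : V₂ →ₗ[R] V₃}
    (h : IsShortExact V₁ V₂ V₃ f g) : clsPlus V₂ = clsPlus V₁ + clsPlus V₃ :=
  Subtype.ext (cls_of_exact h)

theorem clsPlus_prod (V W : GrMod R 𝒜) : clsPlus (V.prod W) = clsPlus V + clsPlus W :=
  Subtype.ext (cls_prod V W)

theorem clsPlus_zero : clsPlus (zero 𝒜) = 0 := Subtype.ext cls_zero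

theorem clsPlus_eq_zero [Subsingleton V] : clsPlus V = 0 := by
  rw [← clsPlus_zero]
  refine clsPlus_eq_of_bijective (f := (0 : V →ₗ[R] zero 𝒜))
    ⟨fun _ _ => rfl, fun _ _ _ => zero_mem _⟩ ⟨fun _ _ _ => Subsingleton.elim _ _, fun _ => ⟨0, rfl⟩⟩

end Proj

section SubQuot

variable {F : Type u} [Field F] {H : Type u} [Ring H] [Algebra F H] {𝒜 : ℤ → Submodule F H}
variable {V : GrMod F 𝒜} {p : Submodule F V}

/-- A graded submodule, as a graded module. -/
def sub (hp : V.IsGrSub p) : GrMod F 𝒜 where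
  carrier := p
  ρ := AlgHom.ofLinearMap
    { toFun := fun h => (V.ρ h).restrict (hp.act h)
      map_add' := fun a b => by ext; simp
      map_smul' := fun a b => by ext; simp }
    (by ext; simp) (fun a b => by ext; simp)
  gr i := (V.gr i).comap p.subtype
  isInternal := by
    refine isInternal_of_proj (fun i => (V.proj i).restrict (hp.proj i)) ?_ ?_ ?_
    · intro i x hx
      exact Subtype.ext (proj_of_mem hx)
    · intro i j hij x hx
      exact Subtype.ext (proj_of_mem_ne hx hij)
    · rw [eq_top_iff]
      rintro ⟨x, hx⟩ -
      obtain ⟨s, hs⟩ := V.exists_sum_proj x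
      have : (⟨x, hx⟩ : p) = ∑ i ∈ s, ⟨V.proj i x, hp.proj i x hx⟩ := by
        ext
        rw [AddSubmonoidClass.coe_finsetSum]
        exact hs.symm
      rw [this]
      exact sum_mem fun i _ => Submodule.mem_iSup_of_mem i (V.proj_mem i x)
  map_mem hh hv := V.map_mem hh hv

theorem isGradedHom_subtype (hp : V.IsGrSub p) : IsGradedHom (sub hp) V p.subtype :=
  ⟨fun _ _ => rfl, fun _ _ hv => hv⟩

/-- The quotient of a graded module by a graded submodule. -/
def quot (hp : V.IsGrSub p) : GrMod F 𝒜 where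
  carrier := V ⧸ p
  ρ := AlgHom.ofLinearMap
    { toFun := fun h => p.mapQ p (V.ρ h) (hp.act h)
      map_add' := fun a b => by ext; simp
      map_smul' := fun a b => by ext; simp }
    (by ext; simp) (fun a b => by ext; simp)
  gr i := (V.gr i).map p.mkQ
  isInternal := by
    refine isInternal_of_proj (fun i => p.mapQ p (V.proj i) (hp.proj i)) ?_ ?_ ?_
    · rintro i _ ⟨x, hx, rfl⟩
      simp [proj_of_mem hx]
    · rintro i j hij _ ⟨x, hx, rfl⟩
      simp [proj_of_mem_ne hx hij]
    · rw [← Submodule.map_iSup, iSup_gr, Submodule.map_top, Submodule.range_mkQ]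
  map_mem := by
    rintro i j h _ hh ⟨x, hx, rfl⟩
    exact ⟨_, V.map_mem hh hx, rfl⟩

theorem isGradedHom_mkQ (hp : V.IsGrSub p) : IsGradedHom V (quot hp) p.mkQ :=
  ⟨fun _ _ => rfl, fun _ _ hv => ⟨_, hv, rfl⟩⟩

theorem isShortExact_sub_quot (hp : V.IsGrSub p) :
    IsShortExact (sub hp) V (quot hp) p.subtype p.mkQ where
  hom_left := isGradedHom_subtype hp
  hom_right := isGradedHom_mkQ hp
  injective := p.subtype_injective
  exact := LinearMap.exact_subtype_mkQ p
  surjective := p.mkQ_surjective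

theorem finrank_sub_lt (hp : V.IsGrSub p) (h : p ≠ ⊤) :
    Module.finrank F (sub hp) < Module.finrank F V :=
  Submodule.finrank_lt h

theorem finrank_quot_lt (hp : V.IsGrSub p) (h : p ≠ ⊥) :
    Module.finrank F (quot hp) < Module.finrank F V := by
  have h1 := p.finrank_quotient_add_finrank
  have h2 : 0 < Module.finrank F p := Submodule.one_le_finrank_iff.2 h
  change Module.finrank F (V ⧸ p) < _
  omega

/-- Induction on graded modules along short exact sequences. -/
theorem exact_induction {P : GrMod F 𝒜 → Prop} (h0 : ∀ V : GrMod F 𝒜, Subsingleton V → P V)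
    (h1 : ∀ V : GrMod F 𝒜, V.IsSimple → P V)
    (h2 : ∀ (V : GrMod F 𝒜) (p : Submodule F V) (hp : V.IsGrSub p),
      P (sub hp) → P (quot hp) → P V) (V : GrMod F 𝒜) : P V := by
  induction hn : Module.finrank F V using Nat.strong_induction_on generalizing V with
  | _ n ih =>
    subst hn
    by_cases hs : V.IsSimple
    · exact h1 V hs
    cases subsingleton_or_nontrivial V with
    | inl h => exact h0 V h
    | inr h =>
      have : ∃ p, V.IsGrSub p ∧ p ≠ ⊥ ∧ p ≠ ⊤ := by
        by_contra! hc
        exact hs ⟨h, fun p hp => or_iff_not_imp_left.2 (hc p hp)⟩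
      obtain ⟨p, hp, hb, ht⟩ := this
      exact h2 V p hp (ih _ (finrank_sub_lt hp ht) _ rfl) (ih _ (finrank_quot_lt hp hb) _ rfl)

/-- A composition series, recorded only as a sum of classes. Uniqueness of the factors is not
needed: it is replaced by the comparison of characteristic polynomials. -/
theorem exists_list_simple (V : GrMod F 𝒜) :
    ∃ l : List (GrMod F 𝒜), (∀ S ∈ l, S.IsSimple) ∧ (l.map clsPlus).sum = clsPlus V := by
  induction V using exact_induction with
  | h0 V hV => exact ⟨[], by simp, by simp [clsPlus_eq_zero]⟩
  | h1 V hV => exact ⟨[V], by simp [hV], by simp⟩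
  | h2 V p hp ih₁ ih₂ =>
    obtain ⟨l₁, h₁, e₁⟩ := ih₁
    obtain ⟨l₂, h₂, e₂⟩ := ih₂
    refine ⟨l₁ ++ l₂, ?_, ?_⟩
    · intro S hS
      rcases List.mem_append.1 hS with h | h
      exacts [h₁ S h, h₂ S h]
    · rw [List.map_append, List.sum_append, e₁, e₂, (isShortExact_sub_quot hp).clsPlus_eq]

end SubQuot

end GrMod

/-! ## Injectivity of the map of graded characteristic polynomials -/

namespace GrMod

section Field

variable {F : Type u} [Field F] {H : Type u} [Ring H] [Algebra F H] {𝒜 : ℤ → Submodule F H}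

theorem IsGrSub.comap {V W : GrMod F 𝒜} {p : Submodule F W} (hp : W.IsGrSub p) {f : V →ₗ[F] W}
    (hf : IsGradedHom V W f) : V.IsGrSub (p.comap f) where
  act h v hv := by
    rw [Submodule.mem_comap] at hv ⊢
    rw [hf.map_action]
    exact hp.act h _ hv
  proj i v hv := by
    rw [Submodule.mem_comap] at hv ⊢
    rw [hf.map_proj]
    exact hp.proj i _ hv

theorem isGradedHom_inl (V W : GrMod F 𝒜) : IsGradedHom V (V.prod W) (LinearMap.inl F V W) :=
  ⟨fun h v => by
    change (V.ρ h v, (0 : W)) = (V.ρ h v, W.ρ h 0)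
    rw [map_zero], fun _ _ hv => ⟨hv, zero_mem _⟩⟩

theorem isGradedHom_inr (V W : GrMod F 𝒜) : IsGradedHom W (V.prod W) (LinearMap.inr F V W) :=
  ⟨fun h v => by
    change ((0 : V), W.ρ h v) = (V.ρ h 0, W.ρ h v)
    rw [map_zero], fun _ _ hv => ⟨zero_mem _, hv⟩⟩

theorem isGradedHom_fst (V W : GrMod F 𝒜) : IsGradedHom (V.prod W) V (LinearMap.fst F V W) :=
  ⟨fun _ _ => rfl, fun _ _ hv => hv.1⟩

theorem isGradedHom_snd (V W : GrMod F 𝒜) : IsGradedHom (V.prod W) W (LinearMap.snd F V W) :=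
  ⟨fun _ _ => rfl, fun _ _ hv => hv.2⟩

theorem IsGradedHom.comp {U V W : GrMod F 𝒜} {g : V →ₗ[F] W} {f : U →ₗ[F] V}
    (hg : IsGradedHom V W g) (hf : IsGradedHom U V f) : IsGradedHom U W (g ∘ₗ f) where
  map_action h v := by simp [hf.map_action, hg.map_action]
  map_gr i v hv := hg.map_gr i _ (hf.map_gr i v hv)

/-- The elements of `H₀` annihilating a set of vectors. -/
def annZero (T : GrMod F 𝒜) (X : Set T) : Submodule F H where
  carrier := {h | h ∈ 𝒜 0 ∧ ∀ x ∈ X, T.ρ h x = 0}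
  zero_mem' := ⟨zero_mem _, fun x _ => by simp⟩
  add_mem' ha hb := ⟨add_mem ha.1 hb.1, fun x hx => by simp [ha.2 x hx, hb.2 x hx]⟩
  smul_mem' c a ha := ⟨Submodule.smul_mem _ c ha.1, fun x hx => by simp [ha.2 x hx]⟩

theorem annZero_le (T : GrMod F 𝒜) (X : Set T) : T.annZero X ≤ 𝒜 0 := fun _ h => h.1

theorem poly_eval_ne_zero {T : GrMod F 𝒜} {i : ℤ} {e : 𝒜 0}
    (h : ∀ t ∈ T.gr i, T.ρ e t = 0) {c : F} (hc : c ≠ 0) : (T.poly e i).eval c ≠ 0 := by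
  have h0 : T.ρDeg i e = 0 := LinearMap.ext fun t => Subtype.ext (h t t.2)
  rw [poly, h0, LinearMap.charpoly_zero]
  simp [hc]

theorem poly_eval_eq_zero {S : GrMod F 𝒜} {i : ℤ} {e : 𝒜 0} {s : S} (hs : s ∈ S.gr i)
    (hs0 : s ≠ 0) {c : F} (h : S.ρ e s = c • s) : (S.poly e i).eval c = 0 := by
  have : Module.End.HasEigenvalue (S.ρDeg i e) c :=
    Module.End.hasEigenvalue_of_hasEigenvector (x := ⟨s, hs⟩)
      ⟨Module.End.mem_eigenspace_iff.2 (Subtype.ext h),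
        fun h => hs0 (congrArg Subtype.val h)⟩
  exact (Module.End.hasEigenvalue_iff_isRoot_charpoly _ _).1 this

variable [GradedAlgebra 𝒜]

/-- An `H₀`-submodule of a homogeneous component `V_i` is the component of degree `i` of a
graded submodule. -/
theorem exists_isGrSub_of_le_gr (V : GrMod F 𝒜) {i : ℤ} {q : Submodule F V} (hq : q ≤ V.gr i)
    (hact : ∀ h ∈ 𝒜 0, ∀ v ∈ q, V.ρ h v ∈ q) :
    ∃ p, V.IsGrSub p ∧ q ≤ p ∧ p ⊓ V.gr i ≤ q := by
  -- The graded submodule is `H q`. Its part of degree `j` is `H_{j-i} q`, and its part of degree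
  -- `i` is `H₀ q = q`.
  let r : ℤ → Submodule F V := fun j =>
    Submodule.span F {x | ∃ h ∈ 𝒜 (j - i), ∃ v ∈ q, V.ρ h v = x}
  have hr : ∀ j, r j ≤ V.gr j := fun j => by
    refine Submodule.span_le.2 ?_
    rintro _ ⟨h, hh, v, hv, rfl⟩
    have := V.map_mem hh (hq hv)
    rwa [sub_add_cancel] at this
  have hr' : ∀ (a j : ℤ) (h : H) (v : V), h ∈ 𝒜 a → v ∈ r j → V.ρ h v ∈ r (a + j) := by
    intro a j h v hh hv
    have : r j ≤ (r (a + j)).comap (V.ρ h) := by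
      refine Submodule.span_le.2 ?_
      rintro _ ⟨g, hg, v, hv, rfl⟩
      refine Submodule.subset_span ⟨h * g, ?_, v, hv, V.ρ_mul h g v⟩
      rw [add_sub_assoc]
      exact SetLike.mul_mem_graded hh hg
    exact this hv
  refine ⟨⨆ j, r j, isGrSub_iSup hr hr', ?_, ?_⟩
  · intro v hv
    refine Submodule.mem_iSup_of_mem i (Submodule.subset_span ⟨1, ?_, v, hv, V.ρ_one v⟩)
    rw [sub_self]
    exact SetLike.one_mem_graded 𝒜
  · rintro v ⟨hv, hvi⟩
    have h1 := proj_mem_of_mem_iSup hr hv i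
    rw [proj_of_mem hvi] at h1
    have : r i ≤ q := by
      refine Submodule.span_le.2 ?_
      rintro _ ⟨g, hg, v, hv, rfl⟩
      rw [sub_self] at hg
      exact hact g hg v hv
    exact this h1

/-- The homogeneous components of a simple graded module are simple over `H₀` or zero. -/
theorem IsSimple.gr_le {S : GrMod F 𝒜} (hS : S.IsSimple) {i : ℤ} {q : Submodule F S}
    (hq : q ≤ S.gr i) (hact : ∀ h ∈ 𝒜 0, ∀ v ∈ q, S.ρ h v ∈ q) (h0 : q ≠ ⊥) :
    S.gr i ≤ q := by
  obtain ⟨p, hp, hqp, hpq⟩ := S.exists_isGrSub_of_le_gr hq hact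
  rcases hS.eq_bot_or_eq_top p hp with rfl | rfl
  · exact absurd (le_bot_iff.1 hqp) h0
  · rwa [top_inf_eq] at hpq

/-- `J s` is a nonzero `H₀`-submodule of `S_i`, hence all of `S_i`, and so contains `s`. -/
theorem IsSimple.exists_act_eq {S : GrMod F 𝒜} (hS : S.IsSimple) {i : ℤ} {J : Submodule F H}
    (hJ : J ≤ 𝒜 0) (hJ' : ∀ g ∈ 𝒜 0, ∀ h ∈ J, g * h ∈ J) {s : S} (hs : s ∈ S.gr i)
    (h0 : ∃ h ∈ J, S.ρ h s ≠ 0) : ∃ e ∈ J, S.ρ e s = s := by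
  have := hS.gr_le (q := J.map (S.ρ.toLinearMap.flip s)) (i := i) ?_ ?_ ?_ hs
  · obtain ⟨e, he, he'⟩ := this
    exact ⟨e, he, he'⟩
  · rintro _ ⟨h, hh, rfl⟩
    have := S.map_mem (hJ hh) hs
    rwa [zero_add] at this
  · rintro g hg _ ⟨h, hh, rfl⟩
    exact ⟨g * h, hJ' g hg h hh, S.ρ_mul g h s⟩
  · obtain ⟨h, hh, hhs⟩ := h0
    intro hc
    exact hhs ((Submodule.mem_bot F).1 (hc ▸ ⟨h, hh, rfl⟩))

/-- A Goursat argument. The pairs `(h t, h s)` with `h ∈ J` generate a graded submodule `p` of `T ×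
S` having exactly these pairs in degree `i`. By simplicity and `hts`, `p` meets each factor
trivially, so it is the graph of an isomorphism `T ≅ S`. -/
theorem IsSimple.clsPlus_eq {T S : GrMod F 𝒜} (hT : T.IsSimple) (hS : S.IsSimple) {i : ℤ}
    {J : Submodule F H} (hJ : J ≤ 𝒜 0) (hJ' : ∀ g ∈ 𝒜 0, ∀ h ∈ J, g * h ∈ J) {t : T} {s : S}
    (ht : t ∈ T.gr i) (hs : s ∈ S.gr i) (hts : ∀ h ∈ J, T.ρ h t = 0 → S.ρ h s = 0)
    (h0 : ∃ h ∈ J, S.ρ h s ≠ 0) : clsPlus T = clsPlus S := by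
  obtain ⟨g, hg, hgs⟩ := h0
  have hgi : ∀ h ∈ J, S.ρ h s ∈ S.gr i := fun h hh => by
    have := S.map_mem (hJ hh) hs
    rwa [zero_add] at this
  obtain ⟨p, hp, hqp, hpq⟩ := (T.prod S).exists_isGrSub_of_le_gr (i := i)
    (q := J.map ((T.ρ.toLinearMap.flip t).prod (S.ρ.toLinearMap.flip s))) (by
      rintro _ ⟨h, hh, rfl⟩
      have := T.map_mem (hJ hh) ht
      rw [zero_add] at this
      exact ⟨this, hgi h hh⟩) (by
      rintro a ha _ ⟨h, hh, rfl⟩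
      exact ⟨a * h, hJ' a ha h hh, Prod.ext (T.ρ_mul a h t) (S.ρ_mul a h s)⟩)
  have hf₁ : IsGradedHom (sub hp) T (LinearMap.fst F T S ∘ₗ p.subtype) :=
    (isGradedHom_fst T S).comp (isGradedHom_subtype hp)
  have hf₂ : IsGradedHom (sub hp) S (LinearMap.snd F T S ∘ₗ p.subtype) :=
    (isGradedHom_snd T S).comp (isGradedHom_subtype hp)
  have hgp : ((T.ρ g t, S.ρ g s) : T × S) ∈ p := hqp ⟨g, hg, rfl⟩
  have hgt : T.ρ g t ≠ 0 := fun h => hgs (hts g hg h)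
  have b₁ : ∀ y : S, ((0 : T), y) ∈ p → y = 0 := by
    rcases hS.eq_bot_or_eq_top _ (hp.comap (isGradedHom_inr T S)) with h | h
    · intro y hy
      exact (Submodule.mem_bot F).1 (h.le hy)
    · exfalso
      -- If `p` contained `0 × S`, then `(0, g s)` would equal `(h t, h s)` for some `h ∈ J`; `hts`
      -- turns `h t = 0` into `g s = h s = 0`.
      have : ((0 : T), S.ρ g s) ∈ p := h.ge (Submodule.mem_top (x := S.ρ g s))
      obtain ⟨h, hh, e⟩ := hpq ⟨this, ⟨zero_mem (T.gr i), hgi g hg⟩⟩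
      have e₁ : T.ρ h t = 0 := congrArg Prod.fst e
      have e₂ : S.ρ h s = S.ρ g s := congrArg Prod.snd e
      exact hgs (e₂ ▸ hts h hh e₁)
  have b₂ : ∀ x : T, (x, (0 : S)) ∈ p → x = 0 := by
    rcases hT.eq_bot_or_eq_top _ (hp.comap (isGradedHom_inl T S)) with h | h
    · intro y hy
      exact (Submodule.mem_bot F).1 (h.le hy)
    · exfalso
      -- If `p` contained `T × 0`, subtracting `(g t, 0)` from `(g t, g s)` would leave `(0, g s)`,
      -- which `b₁` excludes.
      have : (T.ρ g t, (0 : S)) ∈ p := h.ge (Submodule.mem_top (x := T.ρ g t))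
      have h2 := sub_mem hgp this
      have h3 : (T.ρ g t, S.ρ g s) - (T.ρ g t, (0 : S)) = (0, S.ρ g s) := by simp
      exact hgs (b₁ _ (h3 ▸ h2))
  have c₁ : clsPlus (sub hp) = clsPlus T := by
    refine clsPlus_eq_of_bijective hf₁ ⟨?_, hT.surjective hf₁ fun h => ?_⟩
    · rw [← LinearMap.ker_eq_bot, LinearMap.ker_eq_bot']
      rintro ⟨⟨x, y⟩, hxy⟩ (rfl : x = 0)
      exact Subtype.ext (Prod.ext rfl (b₁ y hxy))
    · exact hgt (LinearMap.congr_fun h ⟨_, hgp⟩)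
  have c₂ : clsPlus (sub hp) = clsPlus S := by
    refine clsPlus_eq_of_bijective hf₂ ⟨?_, hS.surjective hf₂ fun h => ?_⟩
    · rw [← LinearMap.ker_eq_bot, LinearMap.ker_eq_bot']
      rintro ⟨⟨x, y⟩, hxy⟩ (rfl : y = 0)
      exact Subtype.ext (Prod.ext (b₂ x hxy) rfl)
    · exact hgs (LinearMap.congr_fun h ⟨_, hgp⟩)
  rw [← c₁, c₂]

theorem mul_mem_annZero (T : GrMod F 𝒜) (X : Set T) (g : H) (hg : g ∈ 𝒜 0) (h : H)
    (hh : h ∈ T.annZero X) : g * h ∈ T.annZero X := by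
  refine ⟨?_, fun x hx => by rw [ρ_mul, hh.2 x hx, map_zero]⟩
  have := SetLike.mul_mem_graded hg hh.1
  rwa [add_zero] at this

/-- As in the density theorem, vectors of `T_i` are killed one at a time, each annihilator being a
left ideal of `H₀`. -/
theorem IsSimple.exists_separating_finset {T S : GrMod F 𝒜} (hT : T.IsSimple)
    (hS : S.IsSimple) (hTS : clsPlus T ≠ clsPlus S) {i : ℤ} {s : S} (hs : s ∈ S.gr i)
    (hs0 : s ≠ 0) (X : Finset T) (hX : ∀ x ∈ X, x ∈ T.gr i) :
    ∃ e ∈ T.annZero (X : Set T), S.ρ e s = s := by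
  classical
  induction X using Finset.induction_on with
  | empty => exact ⟨1, ⟨SetLike.one_mem_graded 𝒜, by simp⟩, S.ρ_one s⟩
  | insert t X _ ih =>
    obtain ⟨e, he, hes⟩ := ih fun x hx => hX x (Finset.mem_insert_of_mem hx)
    refine hS.exists_act_eq (T.annZero_le _) (T.mul_mem_annZero _) hs ?_
    -- If everything killing both `X` and `t` killed `s`, then `h t = 0` would imply `h s = 0` for
    -- all `h` in the annihilator of `X`, and `T` and `S` would have the same class.
    by_contra! hc
    refine hTS (hT.clsPlus_eq hS (T.annZero_le _) (T.mul_mem_annZero (X : Set T))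
      (hX t (Finset.mem_insert_self t X)) hs (fun h hh ht => hc h ⟨hh.1, ?_⟩)
      ⟨e, he, hes.symm ▸ hs0⟩)
    intro x hx
    rcases Finset.mem_insert.1 (Finset.mem_coe.1 hx) with rfl | hx
    exacts [ht, hh.2 x hx]

theorem IsSimple.exists_separating {T S : GrMod F 𝒜} (hT : T.IsSimple)
    (hS : S.IsSimple) (hTS : clsPlus T ≠ clsPlus S) {i : ℤ} {s : S} (hs : s ∈ S.gr i)
    (hs0 : s ≠ 0) : ∃ e ∈ 𝒜 0, (∀ t ∈ T.gr i, T.ρ e t = 0) ∧ S.ρ e s = s := by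
  obtain ⟨X, hX⟩ := Submodule.fg_def.1 (IsNoetherian.noetherian (T.gr i))
  obtain ⟨e, he, hes⟩ := hT.exists_separating_finset hS hTS hs hs0 hX.1.toFinset
    (fun x hx => hX.2 ▸ Submodule.subset_span (hX.1.mem_toFinset.1 hx))
  refine ⟨e, he.1, ?_, hes⟩
  have : T.gr i ≤ LinearMap.ker (T.ρ e) := by
    rw [← hX.2]
    exact Submodule.span_le.2 fun x hx => he.2 x (by simpa using hx)
  exact this

theorem exists_separating_list (l : List (GrMod F 𝒜)) (hl : ∀ T ∈ l, T.IsSimple)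
    {S : GrMod F 𝒜} (hS : S.IsSimple) (hlS : ∀ T ∈ l, clsPlus T ≠ clsPlus S) {i : ℤ} {s : S}
    (hs : s ∈ S.gr i) (hs0 : s ≠ 0) :
    ∃ e ∈ 𝒜 0, (∀ T ∈ l, ∀ t ∈ T.gr i, T.ρ e t = 0) ∧ S.ρ e s = s := by
  induction l with
  | nil => exact ⟨1, SetLike.one_mem_graded 𝒜, by simp, S.ρ_one s⟩
  | cons T l ih =>
    obtain ⟨e, he, hel, hes⟩ := ih (fun T' h => hl T' (List.mem_cons_of_mem _ h))
      (fun T' h => hlS T' (List.mem_cons_of_mem _ h))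
    obtain ⟨f, hf, hfT, hfs⟩ := (hl T List.mem_cons_self).exists_separating hS
      (hlS T List.mem_cons_self) hs hs0
    refine ⟨f * e, ?_, ?_, by rw [ρ_mul, hes, hfs]⟩
    · have := SetLike.mul_mem_graded hf he
      rwa [add_zero] at this
    · intro T' hT' t ht
      rw [ρ_mul]
      rcases List.mem_cons.1 hT' with rfl | hT'
      · have := T'.map_mem he ht
        rw [zero_add] at this
        exact hfT _ this
      · rw [hel T' hT' t ht, map_zero]

end Field

end GrMod

/-! ### Comparison of classes through characteristic polynomials -/

section PolyMap

variable {F : Type u} [Field F] {H : Type u} [Ring H] [Algebra F H] {𝒜 : ℤ → Submodule F H}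

open GrMod

theorem polyMap_add (x y : R0Plus 𝒜) (h : 𝒜 0) (i : ℤ) :
    polyMap (x + y) h i = polyMap x h i * polyMap y h i := by
  obtain ⟨V, rfl⟩ := clsPlus_surjective x
  obtain ⟨W, rfl⟩ := clsPlus_surjective y
  rw [← clsPlus_prod, polyMap_clsPlus, polyMap_clsPlus, polyMap_clsPlus]
  exact poly_of_exact (f := LinearMap.inl F V W) (g := LinearMap.snd F V W)
    ⟨isGradedHom_inl V W, isGradedHom_snd V W, LinearMap.inl_injective, Function.Exact.inl_snd,
      LinearMap.snd_surjective⟩ h i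

theorem polyMap_monic (x : R0Plus 𝒜) (h : 𝒜 0) (i : ℤ) : (polyMap x h i).Monic :=
  LinearMap.charpoly_monic _

theorem polyMap_zero (h : 𝒜 0) (i : ℤ) : polyMap (0 : R0Plus 𝒜) h i = 1 := by
  have := polyMap_add (0 : R0Plus 𝒜) 0 h i
  rw [add_zero] at this
  exact (mul_eq_left₀ (polyMap_monic 0 h i).ne_zero).1 this.symm

theorem polyMap_list_sum (l : List (GrMod F 𝒜)) (h : 𝒜 0) (i : ℤ) :
    polyMap (l.map clsPlus).sum h i = (l.map fun T => T.poly h i).prod := by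
  induction l with
  | nil => simp [polyMap_zero]
  | cons T l ih => simp [polyMap_add, ih, polyMap_clsPlus]

/-- The claim `key` finds a constituent of `m` in the class of a given constituent `S` of the other
list; removing both gives an induction on `l`. The set `D` makes it enough to test elements of `H₀`
up to nonzero scalars. -/
theorem list_sum_clsPlus_eq [GradedAlgebra 𝒜] {D : Set (𝒜 0)}
    (hD : ∀ e : 𝒜 0, ∃ c : F, c ≠ 0 ∧ c • e ∈ D) (l m : List (GrMod F 𝒜))
    (hl : ∀ T ∈ l, T.IsSimple) (hm : ∀ T ∈ m, T.IsSimple)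
    (h : ∀ e ∈ D, polyMap (l.map clsPlus).sum e = polyMap (m.map clsPlus).sum e) :
    (l.map clsPlus).sum = (m.map clsPlus).sum := by
  have key : ∀ (S : GrMod F 𝒜) (l m : List (GrMod F 𝒜)), S.IsSimple → (∀ T ∈ m, T.IsSimple) →
      (∀ e ∈ D, polyMap (clsPlus S + (l.map clsPlus).sum) e = polyMap (m.map clsPlus).sum e) →
      ∃ T ∈ m, clsPlus T = clsPlus S := by
    intro S l m hS hm h
    by_contra! hc
    obtain ⟨i, s, hs, hs0⟩ := hS.exists_gr_ne_zero
    obtain ⟨e, he, hem, hes⟩ := exists_separating_list m hm hS hc hs hs0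
    obtain ⟨c, hc0, hcD⟩ := hD ⟨e, he⟩
    obtain ⟨e', he'D, he'⟩ : ∃ e' ∈ D, (e' : H) = c • e := ⟨_, hcD, rfl⟩
    have hes' : S.ρ e' s = c • s := by rw [he', map_smul, LinearMap.smul_apply, hes]
    -- On `S_i` the element `e' = c • e` has eigenvalue `c`, while on each `T_i` it is zero, so its
    -- characteristic polynomial there is a power of `X` and does not vanish at `c ≠ 0`.
    have h1 := congrArg (Polynomial.eval c) (congrFun (h _ he'D) i)
    rw [polyMap_add, Polynomial.eval_mul, polyMap_clsPlus,
      poly_eval_eq_zero hs hs0 hes', zero_mul, polyMap_list_sum,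
      Polynomial.eval_list_prod, eq_comm, List.prod_eq_zero_iff, List.map_map] at h1
    obtain ⟨T, hT, hT0⟩ := List.mem_map.1 h1
    refine poly_eval_ne_zero (fun t ht => ?_) hc0 hT0
    rw [he', map_smul, LinearMap.smul_apply, hem T hT t ht, smul_zero]
  induction l generalizing m with
  | nil =>
    cases m with
    | nil => rfl
    | cons T m =>
      obtain ⟨T', hT', -⟩ := key T m [] (hm T List.mem_cons_self) (by simp)
        (fun e he => by rw [h e he, List.map_cons, List.sum_cons])
      simp at hT'
  | cons S l ih =>
    rw [List.map_cons, List.sum_cons] at h ⊢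
    obtain ⟨T, hT, hTS⟩ := key S l m (hl S List.mem_cons_self) hm h
    obtain ⟨m₁, m₂, rfl⟩ := List.append_of_mem hT
    have e : ((m₁ ++ T :: m₂).map clsPlus).sum = clsPlus S + ((m₁ ++ m₂).map clsPlus).sum := by
      simp only [List.map_append, List.map_cons, List.sum_append, List.sum_cons, hTS]
      abel
    rw [e] at h ⊢
    rw [ih (m₁ ++ m₂) (fun T hT => hl T (List.mem_cons_of_mem _ hT)) ?_ ?_]
    · intro T hT
      refine hm T ?_
      rcases List.mem_append.1 hT with h | h
      · exact List.mem_append_left _ h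
      · exact List.mem_append_right _ (List.mem_cons_of_mem _ h)
    · intro a ha
      funext i
      have := congrFun (h a ha) i
      rw [polyMap_add, polyMap_add] at this
      exact mul_left_cancel₀ (polyMap_monic _ a i).ne_zero this

/-- A graded module is determined, in the Grothendieck group, by the characteristic polynomials
on its homogeneous components of sufficiently many elements of `H₀`. -/
theorem eq_of_polyMap_eq [GradedAlgebra 𝒜] {D : Set (𝒜 0)}
    (hD : ∀ e : 𝒜 0, ∃ c : F, c ≠ 0 ∧ c • e ∈ D) {x y : R0Plus 𝒜}
    (hxy : ∀ e ∈ D, polyMap x e = polyMap y e) : x = y := by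
  obtain ⟨V, rfl⟩ := clsPlus_surjective x
  obtain ⟨W, rfl⟩ := clsPlus_surjective y
  obtain ⟨l, hl, el⟩ := exists_list_simple V
  obtain ⟨m, hm, em⟩ := exists_list_simple W
  rw [← el, ← em] at hxy ⊢
  exact list_sum_clsPlus_eq hD l m hl hm hxy

end PolyMap

/-! ## Characteristic polynomials under extension of scalars -/

section DivPow

-- Over `R[X]`, the matrix `X - M` divides `f(X) - f(M) = f(X)`, a scalar matrix; take determinants.
-- Unlike divisibility of `f` by a minimal polynomial, this works over any commutative ring.
open Polynomial in
theorem _root_.Matrix.charpoly_dvd_pow_of_aeval_eq_zero {R n : Type*} [CommRing R] [Fintype n]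
    [DecidableEq n] (M : Matrix n n R) {f : R[X]} (hf : aeval M f = 0) :
    M.charpoly ∣ f ^ Fintype.card n := by
  -- In two variables, `f(Y) - f(X) = (Y - X) q(Y)` with `q` over `R[X]`; next `Y` is specialised to
  -- `M`.
  obtain ⟨q, hq⟩ := X_sub_C_dvd_sub_C_eval (a := (X : R[X])) (p := f.map C)
  have h1 := congrArg (aeval (R := R[X]) (M.map C)) hq
  have h2 : aeval (R := R[X]) (M.map C) (f.map C) = 0 := by
    have : aeval (M.map C) f = (aeval M f).map C :=
      aeval_algHom_apply (Algebra.ofId R R[X]).mapMatrix M f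
    rw [hf, Matrix.map_zero _ (map_zero _)] at this
    rw [← this]
    exact aeval_map_algebraMap R[X] (M.map C) f
  have h3 : eval X (f.map C) = f := by rw [eval_map, eval₂_C_X]
  rw [h3, map_sub, h2, map_mul, map_sub, aeval_X, aeval_C, aeval_C, zero_sub] at h1
  have h4 : M.charmatrix = algebraMap R[X] (Matrix n n R[X]) X - M.map C := by
    rw [Matrix.charmatrix]
    rfl
  have h5 : algebraMap R[X] (Matrix n n R[X]) f = M.charmatrix * aeval (M.map C) q := by
    rw [h4, ← neg_sub (M.map C), neg_mul, ← h1, neg_neg]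
  have h6 := congrArg Matrix.det h5
  rw [Matrix.det_mul, Algebra.algebraMap_eq_smul_one, Matrix.det_smul, Matrix.det_one,
    mul_one] at h6
  exact ⟨_, h6⟩

open Polynomial in
theorem _root_.LinearMap.charpoly_dvd_pow_of_aeval_eq_zero {R M : Type*} [CommRing R]
    [AddCommGroup M] [Module R M] [Module.Finite R M] [Module.Free R M] (T : Module.End R M)
    {f : R[X]} (hf : aeval T f = 0) : ∃ n, LinearMap.charpoly T ∣ f ^ n := by
  let b := Module.Free.chooseBasis R M
  rw [← LinearMap.charpoly_toMatrix T b]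
  refine ⟨_, Matrix.charpoly_dvd_pow_of_aeval_eq_zero _ ?_⟩
  have := aeval_algHom_apply (LinearMap.toMatrixAlgEquiv b).toAlgHom T f
  rw [hf, map_zero] at this
  exact this

/-- The characteristic polynomial of an integral endomorphism of a vector space over the field of
fractions of an integrally closed domain has coefficients in that domain. -/
theorem exists_map_eq_charpoly_of_isIntegral {A K V : Type*} [CommRing A] [IsDomain A]
    [IsIntegrallyClosed A] [Field K] [Algebra A K] [IsFractionRing A K] [AddCommGroup V]
    [Module K V] [Module.Finite K V] (T : Module.End K V) {f : Polynomial A} (hf : f.Monic)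
    (hT : Polynomial.aeval T (f.map (algebraMap A K)) = 0) :
    ∃ p : Polynomial A, p.map (algebraMap A K) = LinearMap.charpoly T := by
  obtain ⟨n, hn⟩ := LinearMap.charpoly_dvd_pow_of_aeval_eq_zero T hT
  rw [← Polynomial.map_pow] at hn
  obtain ⟨p, hp⟩ := IsIntegrallyClosed.eq_map_mul_C_of_dvd K (hf.pow n) hn
  rw [(LinearMap.charpoly_monic T).leadingCoeff, Polynomial.C_1, mul_one] at hp
  exact ⟨p, hp⟩

end DivPow

section Extend

variable {A H : Type u} [CommRing A] [Ring H] [Algebra A H] {𝒜 : ℤ → Submodule A H}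

/-- The homomorphism `BH → CH` for `A → B → C`. -/
def mapScalars (A H : Type u) [CommRing A] [Ring H] [Algebra A H] (B C : Type u) [CommRing B]
    [Algebra A B] [CommRing C] [Algebra A C] [Algebra B C] [IsScalarTower A B C] :
    B ⊗[A] H →ₐ[A] C ⊗[A] H :=
  Algebra.TensorProduct.map (IsScalarTower.toAlgHom A B C) (AlgHom.id A H)

section

variable {B : Type u} [CommRing B] [Algebra A B] (C : Type u) [CommRing C] [Algebra A C]
  [Algebra B C] [IsScalarTower A B C]

@[simp] theorem mapScalars_tmul (b : B) (h : H) :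
    mapScalars A H B C (b ⊗ₜ h) = algebraMap B C b ⊗ₜ h := rfl

theorem mapScalars_mem {i : ℤ} {x : B ⊗[A] H} (hx : x ∈ grBC B 𝒜 i) :
    mapScalars A H B C x ∈ grBC C 𝒜 i := by
  obtain ⟨y, rfl⟩ := hx
  induction y with
  | zero => simp
  | add a b ha hb =>
    rw [map_add, map_add]
    exact add_mem ha hb
  | tmul b h => exact Submodule.tmul_mem_baseChange_of_mem _ h.2

theorem extendRep_mapScalars {V : Type u} [AddCommGroup V] [Module B V]
    (ρ : B ⊗[A] H →ₐ[B] Module.End B V) (x : B ⊗[A] H) :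
    extendRep C ρ (mapScalars A H B C x) = (ρ x).baseChange C := by
  induction x with
  | zero => simp
  | add a b ha hb => rw [map_add, map_add, map_add, ha, hb, LinearMap.baseChange_add]
  | tmul b h =>
    refine TensorProduct.AlgebraTensorModule.curry_injective
      (LinearMap.ext fun c => LinearMap.ext fun v => ?_)
    change extendRep C ρ (algebraMap B C b ⊗ₜ h) (c ⊗ₜ v) = c ⊗ₜ ρ (b ⊗ₜ h) v
    have : (b ⊗ₜ h : B ⊗[A] H) = b • 1 ⊗ₜ h := by rw [TensorProduct.smul_tmul', smul_eq_mul, mul_one]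
    rw [extendRep_tmul_tmul, this, map_smul, LinearMap.smul_apply, TensorProduct.tmul_smul,
      TensorProduct.smul_tmul', Algebra.smul_def]

/-- The action of an element of degree zero on a homogeneous component. -/
def GrMod.actZero (V : GrMod B (grBC B 𝒜)) (i : ℤ) (x : grBC B 𝒜 0) : V.gr i →ₗ[B] V.gr i :=
  (V.ρ (x : B ⊗[A] H)).restrict fun v hv => by
    have := V.map_mem x.2 hv
    rwa [zero_add] at this

theorem GrMod.exists_retraction (V : GrMod B (grBC B 𝒜)) (i : ℤ) :
    ∃ r : V →ₗ[B] V.gr i, r ∘ₗ (V.gr i).subtype = LinearMap.id :=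
  ⟨(V.proj i).codRestrict _ (V.proj_mem i),
    LinearMap.ext fun v => Subtype.ext (GrMod.proj_of_mem v.2)⟩

instance (V : GrMod B (grBC B 𝒜)) (i : ℤ) : Module.Finite B (V.gr i) := by
  obtain ⟨r, hr⟩ := V.exists_retraction i
  exact Module.Finite.of_surjective r fun v => ⟨v, LinearMap.congr_fun hr v⟩

/-- `V_i` is a direct summand of a free module, hence flat, and finitely generated flat modules over
a local ring are free. -/
theorem GrMod.free_gr [IsLocalRing B] (V : GrMod B (grBC B 𝒜)) [Module.Free B V] (i : ℤ) :
    Module.Free B (V.gr i) := by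
  obtain ⟨r, hr⟩ := V.exists_retraction i
  have : Module.Flat B (V.gr i) := Module.Flat.of_retract _ _ hr
  exact Module.free_of_flat_of_isLocalRing

end

/-- Characteristic polynomials commute with base change. Used with `B = O` for both `C = K` and `C =
k`, and also for field extensions. -/
theorem GrMod.poly_extend {B : Type u} [CommRing B] [Algebra A B] (C : Type u) [Field C]
    [Algebra A C] [Algebra B C] [IsScalarTower A B C] (V : GrMod B (grBC B 𝒜)) (i : ℤ)
    [Module.Free B (V.gr i)] (x : grBC B 𝒜 0) :
    (V.extend C).poly ⟨mapScalars A H B C x, mapScalars_mem C x.2⟩ i =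
      (V.actZero i x).charpoly.map (algebraMap B C) := by
  let e : C ⊗[B] V.gr i ≃ₗ[C] (V.extend C).gr i :=
    LinearEquiv.ofBijective _ (DirectSum.IsInternal.toBaseChange_bijective V.gr V.isInternal i)
  rw [← LinearMap.charpoly_baseChange, ← LinearEquiv.charpoly_conj e, poly]
  congr 1
  refine LinearMap.ext fun v => ?_
  obtain ⟨w, rfl⟩ := e.surjective v
  rw [LinearEquiv.conj_apply_apply, e.symm_apply_apply]
  refine Subtype.ext ?_
  change extendRep C V.ρ (mapScalars A H B C x) (e w).1 = _
  rw [extendRep_mapScalars]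
  have key : (V.ρ (x : B ⊗[A] H)).baseChange C ∘ₗ (V.gr i).subtype.baseChange C =
      (V.gr i).subtype.baseChange C ∘ₗ (V.actZero i x).baseChange C := by
    rw [← LinearMap.baseChange_comp, ← LinearMap.baseChange_comp]
    rfl
  exact LinearMap.congr_fun key w

end Extend

/-! ### The map `𝔭` for scalar extensions of `H` -/

section PolyMapBC

variable {A H : Type u} [CommRing A] [Ring H] [Algebra A H] {𝒜 : ℤ → Submodule A H}

theorem polyMapBC_clsPlus_extend {B : Type u} [CommRing B] [Algebra A B] (C : Type u) [Field C]
    [Algebra A C] [Algebra B C] [IsScalarTower A B C] (V : GrMod B (grBC B 𝒜)) (i : ℤ)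
    [Module.Free B (V.gr i)] (h : 𝒜 0) :
    polyMapBC 𝒜 C (clsPlus (V.extend C)) h i =
      (V.actZero i ⟨1 ⊗ₜ (h : H), Submodule.tmul_mem_baseChange_of_mem 1 h.2⟩).charpoly.map
        (algebraMap B C) := by
  rw [← V.poly_extend C i, polyMapBC, polyMap_clsPlus]
  congr 1
  refine Subtype.ext ?_
  change _ = algebraMap B C 1 ⊗ₜ (h : H)
  rw [map_one]

theorem polyMapBC_extendPlus (B : Type u) [Field B] [Algebra A B] (C : Type u) [Field C]
    [Algebra A C] [Algebra B C] [IsScalarTower A B C] (x : R0Plus (grBC B 𝒜)) (h : 𝒜 0) (i : ℤ) :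
    polyMapBC 𝒜 C (extendPlus 𝒜 B C x) h i = (polyMapBC 𝒜 B x h i).map (algebraMap B C) := by
  obtain ⟨V, rfl⟩ := clsPlus_surjective x
  rw [extendPlus, R0Plus.map_clsPlus, polyMapBC_clsPlus_extend, polyMapBC, polyMap_clsPlus]
  rfl

/-- Over a field generated as a field by the image of `A`, the map `𝔭` is injective. -/
theorem polyMapBC_injective [GradedAlgebra 𝒜] (L : Type u) [Field L] [Algebra A L]
    [IsFractionRing (algebraMap A L).range L] : Function.Injective (polyMapBC 𝒜 L) := by
  intro x y hxy
  -- `D` is the image of `H₀`. Clearing denominators moves any element of `L ⊗ H₀` into `D`, since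
  -- elements of `L` are fractions of elements of `θ(A)`.
  refine eq_of_polyMap_eq (D := {e | ∃ h : 𝒜 0, e.1 = 1 ⊗ₜ (h : H)}) ?_ ?_
  · rintro ⟨e, he⟩
    suffices ∃ a : A, algebraMap A L a ≠ 0 ∧ ∃ h : 𝒜 0, algebraMap A L a • e = 1 ⊗ₜ (h : H) by
      obtain ⟨a, ha, h, hh⟩ := this
      exact ⟨algebraMap A L a, ha, h, hh⟩
    obtain ⟨z, rfl⟩ := he
    induction z with
    | zero => exact ⟨1, by simp, 0, by simp⟩
    | add z w hz hw =>
      obtain ⟨a, ha, h, hh⟩ := hz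
      obtain ⟨b, hb, g, hg⟩ := hw
      refine ⟨a * b, by simp [ha, hb], b • h + a • g, ?_⟩
      rw [map_add, smul_add, map_mul, mul_comm, mul_smul, hh, mul_comm, mul_smul, hg]
      simp [TensorProduct.tmul_add, TensorProduct.tmul_smul]
    | tmul c h =>
      obtain ⟨⟨_, b, rfl⟩, ⟨_, a, rfl⟩, ha, rfl⟩ :=
        IsFractionRing.div_surjective (A := (algebraMap A L).range) c
      have ha' : algebraMap A L a ≠ 0 := fun h0 =>
        nonZeroDivisors.ne_zero ha (Subtype.ext h0)
      refine ⟨a, ha', b • h, ?_⟩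
      change algebraMap A L a • ((algebraMap A L b / algebraMap A L a) ⊗ₜ[A] (h : H)) = _
      rw [TensorProduct.smul_tmul', smul_eq_mul, mul_div_cancel₀ _ ha', Submodule.coe_smul,
        TensorProduct.tmul_smul, TensorProduct.smul_tmul', Algebra.smul_def, mul_one]
  · rintro ⟨_, _⟩ ⟨h, rfl⟩
    exact congrFun hxy h

/-- The polynomials over `C` are those over `L` with coefficients embedded in `C`, so they already
determine the class over `L`. -/
theorem extendPlus_injective [GradedAlgebra 𝒜] (L : Type u) [Field L] [Algebra A L]
    [IsFractionRing (algebraMap A L).range L] (C : Type u) [Field C]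
    [Algebra A C] [Algebra L C] [IsScalarTower A L C] :
    Function.Injective (extendPlus 𝒜 L C) := by
  intro x y hxy
  refine polyMapBC_injective (𝒜 := 𝒜) L (funext fun h => funext fun i => ?_)
  apply Polynomial.map_injective _ (algebraMap L C).injective
  rw [← polyMapBC_extendPlus, ← polyMapBC_extendPlus, hxy]

/-- As `H` is finite over `A`, each `h` is a root of a monic `f` over `A`. Then `f` annihilates the
action of `h` on every `V_i`, and integral closedness applies. -/
theorem exists_coeffMap_eq_polyMapBC [IsDomain A] [IsIntegrallyClosed A] [Module.Finite A H]
    (K : Type u) [Field K] [Algebra A K] [IsFractionRing A K] (x : R0Plus (grBC K 𝒜)) :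
    ∃ p : 𝒜 0 → ℤ → Polynomial A, coeffMap A K p = polyMapBC 𝒜 K x := by
  obtain ⟨V, rfl⟩ := clsPlus_surjective x
  have : ∀ (h : 𝒜 0) (i : ℤ), ∃ p : Polynomial A,
      p.map (algebraMap A K) = polyMapBC 𝒜 K (clsPlus V) h i := by
    intro h i
    obtain ⟨f, hf, hfh⟩ := Algebra.IsIntegral.isIntegral (R := A) (h : H)
    rw [polyMapBC, polyMap_clsPlus]
    refine exists_map_eq_charpoly_of_isIntegral _ hf ?_
    have h1 : Polynomial.aeval (V.ρ (1 ⊗ₜ (h : H))) (f.map (algebraMap A K)) = 0 := by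
      rw [Polynomial.aeval_algHom_apply, Polynomial.aeval_map_algebraMap]
      have := Polynomial.aeval_algHom_apply
        (Algebra.TensorProduct.includeRight : H →ₐ[A] K ⊗[A] H) (h : H) f
      rw [Polynomial.aeval_def (h : H), hfh, map_zero] at this
      rw [← Algebra.TensorProduct.includeRight_apply, this, map_zero]
    refine LinearMap.ext fun v => Subtype.ext ?_
    -- Polynomials in the restriction to `V_i` are restrictions of polynomials in the action on `V`.
    have h2 : ∀ g : Polynomial K, ((Polynomial.aeval (V.ρDeg i
        ⟨1 ⊗ₜ (h : H), Submodule.tmul_mem_baseChange_of_mem 1 h.2⟩) g v : V.gr i) : V) =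
        Polynomial.aeval (V.ρ (1 ⊗ₜ (h : H))) g (v : V) := by
      intro g
      induction g using Polynomial.induction_on generalizing v with
      | C a => simp [Algebra.algebraMap_eq_smul_one]
      | add p q hp hq => simp [hp, hq]
      | monomial n a ih =>
        rw [pow_succ, ← mul_assoc, map_mul _ _ Polynomial.X, map_mul _ _ Polynomial.X,
          Module.End.mul_apply, Module.End.mul_apply, ih, Polynomial.aeval_X, Polynomial.aeval_X]
        rfl
    rw [h2, h1]
    rfl
  choose p hp using this
  exact ⟨p, funext fun h => funext fun i => hp h i⟩

end PolyMapBC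

/-! ## Lattices in graded modules -/

section Lattice

variable {A H O K : Type u} [CommRing A] [Ring H] [Algebra A H] {𝒜 : ℤ → Submodule A H}
  [CommRing O] [Algebra A O] [Field K] [Algebra A K] [Algebra O K] [IsScalarTower A O K]

theorem mapScalars_smul (o : O) (x : O ⊗[A] H) :
    mapScalars A H O K (o • x) = algebraMap O K o • mapScalars A H O K x := by
  induction x with
  | zero => simp
  | add a b ha hb => rw [smul_add, map_add, map_add, smul_add, ha, hb]
  | tmul p h => simp [Algebra.smul_def]

namespace GrMod

/-- Used both to compare a lattice with the module containing it and to map a shifted regular module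
onto a simple one. -/
theorem isGradedHom_liftBaseChange {W : GrMod O (grBC O 𝒜)} {V : GrMod K (grBC K 𝒜)}
    [Module O V] [IsScalarTower O K V] {f : W →ₗ[O] V}
    (hf : ∀ (h : H) (w : W), f (W.ρ (1 ⊗ₜ h) w) = V.ρ (1 ⊗ₜ h) (f w))
    (hf' : ∀ (i : ℤ), ∀ w ∈ W.gr i, f w ∈ V.gr i) :
    IsGradedHom (W.extend K) V (f.liftBaseChange K) := by
  have h₁ : ∀ (x : K ⊗[A] H) (v : K ⊗[O] W),
      f.liftBaseChange K (extendRep K W.ρ x v) = V.ρ x (f.liftBaseChange K v) := by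
    intro x v
    induction x with
    | zero => simp
    | add a b ha hb =>
      rw [map_add, map_add, LinearMap.add_apply, LinearMap.add_apply, map_add, ha, hb]
    | tmul c h =>
      induction v with
      | zero => simp
      | add a b ha hb => rw [map_add, map_add, map_add, map_add, ha, hb]
      | tmul d v =>
        have : (c ⊗ₜ h : K ⊗[A] H) = c • 1 ⊗ₜ h := by
          rw [TensorProduct.smul_tmul', smul_eq_mul, mul_one]
        rw [extendRep_tmul_tmul, LinearMap.liftBaseChange_tmul, LinearMap.liftBaseChange_tmul, hf,
          this, map_smul, map_smul, LinearMap.smul_apply, smul_smul, mul_comm]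
  have h₂ : ∀ (i : ℤ) (v : K ⊗[O] W.gr i),
      f.liftBaseChange K ((W.gr i).subtype.baseChange K v) ∈ V.gr i := by
    intro i v
    induction v with
    | zero => simp
    | add a b ha hb =>
      rw [map_add, map_add]
      exact add_mem ha hb
    | tmul d v => exact (V.gr i).smul_mem d (hf' i v v.2)
  refine ⟨h₁, ?_⟩
  rintro i _ ⟨v, rfl⟩
  exact h₂ i v

variable (V : GrMod K (grBC K 𝒜)) [Module O V] [IsScalarTower O K V]

theorem ρ_mapScalars_mem {N : Submodule O V} (hact : ∀ (h : H), ∀ v ∈ N, V.ρ (1 ⊗ₜ h) v ∈ N)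
    (x : O ⊗[A] H) (v : V) (hv : v ∈ N) : V.ρ (mapScalars A H O K x) v ∈ N := by
  induction x with
  | zero => simp
  | add a b ha hb =>
    rw [map_add, map_add, LinearMap.add_apply]
    exact add_mem ha hb
  | tmul p h =>
    have : (p ⊗ₜ h : O ⊗[A] H) = p • 1 ⊗ₜ h := by
      rw [TensorProduct.smul_tmul', smul_eq_mul, mul_one]
    rw [this, mapScalars_smul, mapScalars_tmul, map_one, map_smul, LinearMap.smul_apply,
      algebraMap_smul]
    exact N.smul_mem p (hact h v hv)

/-- A finitely generated `O`-submodule of a graded `KH`-module that is stable under `H` and under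
the projections onto the homogeneous components, as a graded `OH`-module. -/
def lattice (N : Submodule O V) [Module.Finite O N]
    (hact : ∀ (h : H), ∀ v ∈ N, V.ρ (1 ⊗ₜ h) v ∈ N)
    (hproj : ∀ (i : ℤ), ∀ v ∈ N, V.proj i v ∈ N) : GrMod O (grBC O 𝒜) where
  carrier := N
  ρ := AlgHom.ofLinearMap
    { toFun := fun x => ((V.ρ (mapScalars A H O K x)).restrictScalars O).restrict
        (V.ρ_mapScalars_mem hact x)
      map_add' := fun a b => by
        ext v
        change V.ρ (mapScalars A H O K (a + b)) v =
          V.ρ (mapScalars A H O K a) v + V.ρ (mapScalars A H O K b) v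
        rw [map_add, map_add, LinearMap.add_apply]
      map_smul' := fun a b => by
        ext v
        change V.ρ (mapScalars A H O K (a • b)) v = a • V.ρ (mapScalars A H O K b) v
        rw [mapScalars_smul, map_smul, LinearMap.smul_apply, algebraMap_smul] }
    (by
      ext v
      change V.ρ (mapScalars A H O K 1) v = v
      rw [map_one, ρ_one])
    (fun a b => by
      ext v
      change V.ρ (mapScalars A H O K (a * b)) v =
        V.ρ (mapScalars A H O K a) (V.ρ (mapScalars A H O K b) v)
      rw [map_mul, ρ_mul])
  gr i := ((V.gr i).restrictScalars O).comap N.subtype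
  isInternal := by
    refine isInternal_of_proj
      (fun i => ((V.proj i).restrictScalars O).restrict (hproj i)) ?_ ?_ ?_
    · intro i x hx
      exact Subtype.ext (proj_of_mem hx)
    · intro i j hij x hx
      exact Subtype.ext (proj_of_mem_ne hx hij)
    · rw [eq_top_iff]
      rintro ⟨x, hx⟩ -
      obtain ⟨s, hs⟩ := V.exists_sum_proj x
      have : (⟨x, hx⟩ : N) = ∑ i ∈ s, ⟨V.proj i x, hproj i x hx⟩ := by
        ext
        rw [AddSubmonoidClass.coe_finsetSum]
        exact hs.symm
      rw [this]
      exact sum_mem fun i _ => Submodule.mem_iSup_of_mem i (V.proj_mem i x)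
  map_mem hh hv := V.map_mem (mapScalars_mem K hh) hv

theorem isGradedHom_lattice (N : Submodule O V) [Module.Finite O N]
    (hact : ∀ (h : H), ∀ v ∈ N, V.ρ (1 ⊗ₜ h) v ∈ N)
    (hproj : ∀ (i : ℤ), ∀ v ∈ N, V.proj i v ∈ N) :
    IsGradedHom ((V.lattice N hact hproj).extend K) V (N.subtype.liftBaseChange K) :=
  isGradedHom_liftBaseChange (W := V.lattice N hact hproj) (f := N.subtype)
    (fun h (w : N) => by
      change V.ρ (algebraMap O K 1 ⊗ₜ h) (w : V) = _
      rw [map_one]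
      rfl) (fun _ _ hw => hw)

/-- By a common denominator, every tensor has a nonzero multiple of the form `1 ⊗ n`, whose image is
`n` itself. -/
theorem liftBaseChange_injective {V : Type*} [AddCommGroup V] [Module K V] [Module O V]
    [IsScalarTower O K V] [IsDomain O] [IsFractionRing O K] (N : Submodule O V) :
    Function.Injective (N.subtype.liftBaseChange K) := by
  have key : ∀ z : K ⊗[O] N, ∃ d : O, d ≠ 0 ∧ ∃ n : N, d • z = 1 ⊗ₜ n := by
    intro z
    induction z with
    | zero => exact ⟨1, one_ne_zero, 0, by simp⟩
    | add z w hz hw =>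
      obtain ⟨a, ha, n, hn⟩ := hz
      obtain ⟨b, hb, m, hm⟩ := hw
      refine ⟨a * b, mul_ne_zero ha hb, b • n + a • m, ?_⟩
      rw [smul_add, mul_comm, mul_smul, hn, mul_comm, mul_smul, hm]
      simp [TensorProduct.tmul_add, TensorProduct.tmul_smul]
    | tmul c n =>
      obtain ⟨b, a, ha, rfl⟩ := IsFractionRing.div_surjective (A := O) c
      have ha' := nonZeroDivisors.ne_zero ha
      have ha'' : algebraMap O K a ≠ 0 := fun h =>
        ha' ((IsFractionRing.injective O K) (h.trans (map_zero _).symm))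
      refine ⟨a, ha', b • n, ?_⟩
      rw [TensorProduct.smul_tmul', Algebra.smul_def, mul_div_cancel₀ _ ha'',
        TensorProduct.tmul_smul, TensorProduct.smul_tmul', Algebra.smul_def, mul_one]
  rw [← LinearMap.ker_eq_bot, LinearMap.ker_eq_bot']
  intro z hz
  obtain ⟨d, hd, n, hn⟩ := key z
  have hd' : algebraMap O K d ≠ 0 := fun h =>
    hd ((IsFractionRing.injective O K) (h.trans (map_zero _).symm))
  rw [← algebraMap_smul K] at hn
  have h1 := congrArg (N.subtype.liftBaseChange K) hn
  rw [map_smul, hz, smul_zero, LinearMap.liftBaseChange_one_tmul] at h1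
  have h2 : n = 0 := Subtype.ext h1.symm
  rw [h2, TensorProduct.tmul_zero] at hn
  exact (smul_eq_zero.1 hn).resolve_left hd'

theorem exists_homogeneous_finset {R : Type u} [CommRing R] {H : Type u} [Ring H] [Algebra R H]
    {𝒜 : ℤ → Submodule R H} (V : GrMod R 𝒜) :
    ∃ X : Finset V, (∀ x ∈ X, ∃ i, x ∈ V.gr i) ∧ Submodule.span R (X : Set V) = ⊤ := by
  classical
  obtain ⟨X, hX⟩ := Module.Finite.fg_top (R := R) (M := V)
  choose s hs using V.exists_sum_proj
  refine ⟨X.biUnion fun x => (s x).image fun i => V.proj i x, ?_, ?_⟩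
  · intro x hx
    simp only [Finset.mem_biUnion, Finset.mem_image] at hx
    obtain ⟨y, -, i, -, rfl⟩ := hx
    exact ⟨i, V.proj_mem i y⟩
  · rw [eq_top_iff, ← hX]
    refine Submodule.span_le.2 fun x hx => ?_
    rw [← hs x]
    refine sum_mem fun i hi => Submodule.subset_span ?_
    simp only [Finset.coe_biUnion, Finset.coe_image, Set.mem_iUnion]
    exact ⟨x, hx, i, hi, rfl⟩

/-- Every graded `KH`-module contains a full graded `OH`-lattice, for `O` a valuation ring with
field of fractions `K`. -/
theorem exists_lattice [GradedAlgebra 𝒜] [Module.Finite A H] [IsDomain O] [ValuationRing O]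
    [IsFractionRing O K] (V : GrMod K (grBC K 𝒜)) :
    ∃ W : GrMod O (grBC O 𝒜), Module.Free O W ∧ clsPlus (W.extend K) = clsPlus V := by
  classical
  let _ : Module O V := Module.compHom V (algebraMap O K)
  have : IsScalarTower O K V := ⟨fun a b v => by
    rw [Algebra.smul_def, mul_smul]
    rfl⟩
  obtain ⟨B, hB, hBs⟩ := V.exists_homogeneous_finset
  obtain ⟨G, hG⟩ := Module.Finite.fg_top (R := A) (M := H)
  -- The lattice is the `O`-span of `G B`, where `G` generates `H` over `A` and `B` is a finite
  -- homogeneous spanning set of `V`.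
  let N : Submodule O V := Submodule.span O
    ((Finset.image₂ (fun (h : H) (b : V) => V.ρ (1 ⊗ₜ h) b) G B : Finset V) : Set V)
  -- That `f (h v) ∈ N` is an `A`-linear condition on `h`. With `f` the identity it can be checked
  -- on `G`; with `f` a projection, on homogeneous `h`, although `G` need not be homogeneous.
  let M (f : V →ₗ[K] V) (v : V) : Submodule A H :=
    { carrier := {h | f (V.ρ (1 ⊗ₜ h) v) ∈ N}
      zero_mem' := by simp
      add_mem' := fun {a b} ha hb => by
        simp only [Set.mem_ofPred_eq, TensorProduct.tmul_add, map_add, LinearMap.add_apply] at *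
        exact add_mem ha hb
      smul_mem' := fun a h hh => by
        have : (1 ⊗ₜ (a • h) : K ⊗[A] H) = algebraMap O K (algebraMap A O a) • 1 ⊗ₜ h := by
          rw [TensorProduct.tmul_smul, ← IsScalarTower.algebraMap_apply, algebraMap_smul]
        rw [Set.mem_ofPred_eq, this, map_smul, LinearMap.smul_apply, map_smul, algebraMap_smul]
        exact N.smul_mem _ hh }
  have hN : ∀ (h : H), ∀ b ∈ B, V.ρ (1 ⊗ₜ h) b ∈ N := by
    intro h b hb
    have : Submodule.span A (G : Set H) ≤ M LinearMap.id b := Submodule.span_le.2 fun g hg =>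
      Submodule.subset_span (Finset.mem_coe.2 (Finset.mem_image₂_of_mem hg hb))
    rw [hG] at this
    exact this (Submodule.mem_top (x := h))
  have hact : ∀ (h : H), ∀ v ∈ N, V.ρ (1 ⊗ₜ h) v ∈ N := by
    intro h
    have : N ≤ N.comap ((V.ρ (1 ⊗ₜ h)).restrictScalars O) := by
      refine Submodule.span_le.2 fun v hv => ?_
      obtain ⟨g, -, b, hb, rfl⟩ := Finset.mem_image₂.1 (Finset.mem_coe.1 hv)
      change V.ρ (1 ⊗ₜ h) (V.ρ (1 ⊗ₜ g) b) ∈ N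
      rw [← ρ_mul, Algebra.TensorProduct.tmul_mul_tmul, one_mul]
      exact hN _ b hb
    exact this
  have hproj : ∀ (i : ℤ), ∀ v ∈ N, V.proj i v ∈ N := by
    intro i
    have : N ≤ N.comap ((V.proj i).restrictScalars O) := by
      refine Submodule.span_le.2 fun v hv => ?_
      obtain ⟨g, -, b, hb, rfl⟩ := Finset.mem_image₂.1 (Finset.mem_coe.1 hv)
      obtain ⟨j, hj⟩ := hB b hb
      refine algebra_mem_of_homogeneous (𝒜 := 𝒜) (p := M (V.proj i) b) (fun a h hh => ?_) g
      change V.proj i (V.ρ (1 ⊗ₜ h) b) ∈ N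
      have hm := V.map_mem (h := 1 ⊗ₜ h) (Submodule.tmul_mem_baseChange_of_mem 1 hh) hj
      rcases eq_or_ne (a + j) i with rfl | hij
      · rw [proj_of_mem hm]
        exact hN h b hb
      · rw [proj_of_mem_ne hm hij]
        exact zero_mem _
    exact this
  have : Module.Finite O N := Module.Finite.span_of_finite O (Finset.finite_toSet _)
  have : Module.IsTorsionFree O V := Module.IsTorsionFree.trans_faithfulSMul O K V
  -- Torsion-free modules over a Bézout domain are flat; freeness then follows because `O` is local
  -- and `N` is finitely generated.
  have : Module.Flat O N := Module.Flat.flat_iff_torsion_eq_bot_of_isBezout.2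
    (Submodule.isTorsionFree_iff_torsion_eq_bot.1 inferInstance)
  have hsurj : Function.Surjective (N.subtype.liftBaseChange K) := by
    rw [← LinearMap.range_eq_top, eq_top_iff, ← hBs]
    refine Submodule.span_le.2 fun b hb => ?_
    have hbN : b ∈ N := by
      have := hN 1 b hb
      rwa [← Algebra.TensorProduct.one_def, ρ_one] at this
    exact ⟨1 ⊗ₜ ⟨b, hbN⟩, one_smul K b⟩
  exact ⟨V.lattice N hact hproj, Module.free_of_flat_of_isLocalRing (R := O) (P := N),
    clsPlus_eq_of_bijective (V.isGradedHom_lattice N hact hproj)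
      ⟨liftBaseChange_injective N, hsurj⟩⟩

end GrMod

end Lattice

/-! ## Surjectivity of the extension of scalars -/

namespace GrMod

section Regular

variable {R : Type u} [CommRing R] {H : Type u} [Ring H] [Algebra R H]

/-- The regular graded module. -/
def regular (𝒜 : ℤ → Submodule R H) [GradedAlgebra 𝒜] [Module.Finite R H] : GrMod R 𝒜 where
  carrier := H
  ρ := Algebra.lmul R H
  gr := 𝒜
  isInternal := DirectSum.Decomposition.isInternal 𝒜
  map_mem hh hv := SetLike.mul_mem_graded hh hv

variable {𝒜 : ℤ → Submodule R H}

theorem IsGradedHom.exists_factor {V Q S : GrMod R 𝒜} {g : V →ₗ[R] Q} (hg : IsGradedHom V Q g)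
    (hsurj : Function.Surjective g) {φ : V →ₗ[R] S} (hφ : IsGradedHom V S φ)
    (hker : LinearMap.ker g ≤ LinearMap.ker φ) :
    ∃ ψ : Q →ₗ[R] S, IsGradedHom Q S ψ ∧ ψ ∘ₗ g = φ := by
  let e := g.quotKerEquivOfSurjective hsurj
  let ψ : Q →ₗ[R] S := (LinearMap.ker g).liftQ φ hker ∘ₗ e.symm.toLinearMap
  have hψ : ∀ v, ψ (g v) = φ v := fun v => by
    have : e.symm (g v) = (LinearMap.ker g).mkQ v := by
      rw [LinearEquiv.symm_apply_eq]
      rfl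
    change (LinearMap.ker g).liftQ φ hker (e.symm (g v)) = φ v
    rw [this, Submodule.mkQ_apply, Submodule.liftQ_apply]
  refine ⟨ψ, ⟨fun h w => ?_, fun i w hw => ?_⟩, LinearMap.ext hψ⟩
  · obtain ⟨v, rfl⟩ := hsurj w
    rw [← hg.map_action, hψ, hψ, hφ.map_action]
  · obtain ⟨v, rfl⟩ := hsurj w
    obtain ⟨v', hv', e', -⟩ := mem_gr_of_map hg v i hw
    rw [← e', hψ]
    exact hφ.map_gr i v' hv'

end Regular

section ExtendField

variable {A H : Type u} [CommRing A] [Ring H] [Algebra A H] {𝒜 : ℤ → Submodule A H}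
  {L : Type u} [Field L] [Algebra A L] {C : Type u} [Field C] [Algebra A C] [Algebra L C]
  [IsScalarTower A L C]

theorem IsShortExact.extend {V₁ V₂ V₃ : GrMod L (grBC L 𝒜)} {f : V₁ →ₗ[L] V₂} {g : V₂ →ₗ[L] V₃}
    (h : IsShortExact V₁ V₂ V₃ f g) :
    IsShortExact (V₁.extend C) (V₂.extend C) (V₃.extend C) (f.baseChange C)
      (g.baseChange C) where
  hom_left := h.hom_left.extend C
  hom_right := h.hom_right.extend C
  injective := Module.Flat.lTensor_preserves_injective_linearMap (M := C) f h.injective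
  exact := lTensor_exact C h.exact h.surjective
  surjective := LinearMap.lTensor_surjective C h.surjective

/-- A nonzero map to `S` is either nonzero on `C ⊗ p` or factors through `C ⊗ (V / p)`. Descending
this way reaches a simple `V`, where the map is an isomorphism by Schur's lemma. -/
theorem exists_simple_extend_eq
    (hsimp : ∀ V : GrMod L (grBC L 𝒜), V.IsSimple → (V.extend C).IsSimple)
    {S : GrMod C (grBC C 𝒜)} (hS : S.IsSimple) (V : GrMod L (grBC L 𝒜))
    (φ : V.extend C →ₗ[C] S) (hφ : IsGradedHom (V.extend C) S φ) (h0 : φ ≠ 0) :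
    ∃ T : GrMod L (grBC L 𝒜), clsPlus (T.extend C) = clsPlus S := by
  induction V using exact_induction with
  | h0 V hV =>
    refine absurd (LinearMap.ext fun v => ?_) h0
    have : Subsingleton (V.extend C) := inferInstanceAs (Subsingleton (C ⊗[L] V))
    rw [Subsingleton.elim v 0, map_zero, map_zero]
  | h1 V hV =>
    exact ⟨V, clsPlus_eq_of_bijective hφ ⟨(hsimp V hV).injective hφ h0, hS.surjective hφ h0⟩⟩
  | h2 V p hp ih₁ ih₂ =>
    have hex := (isShortExact_sub_quot hp).extend (C := C)
    let f : (sub hp).extend C →ₗ[C] V.extend C := p.subtype.baseChange C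
    by_cases hf : φ ∘ₗ f = 0
    · obtain ⟨ψ, hψ, e⟩ := hex.hom_right.exists_factor hex.surjective hφ (fun v hv => by
        obtain ⟨w, rfl⟩ := (hex.exact v).1 hv
        exact LinearMap.congr_fun hf w)
      exact ih₂ ψ hψ fun hψ0 =>
        h0 (e.symm.trans (LinearMap.ext fun v => LinearMap.congr_fun hψ0 _))
    · exact ih₁ (φ ∘ₗ f) (hφ.comp hex.hom_left) hf

/-- Every simple graded `CH`-module is a quotient of a shifted regular module, which is defined over
`L`; hence its class comes from a constituent over `L`. -/
theorem extendPlus_surjective [GradedAlgebra 𝒜] [Module.Finite A H]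
    (hsimp : ∀ V : GrMod L (grBC L 𝒜), V.IsSimple → (V.extend C).IsSimple) :
    Function.Surjective (extendPlus 𝒜 L C) := by
  have key : ∀ S : GrMod C (grBC C 𝒜), S.IsSimple →
      clsPlus S ∈ AddMonoidHom.mrange (extendPlus 𝒜 L C) := by
    intro S hS
    obtain ⟨j, s, hs, hs0⟩ := hS.exists_gr_ne_zero
    let _ : Module L S := Module.compHom S (algebraMap L C)
    have : IsScalarTower L C S := ⟨fun a b v => by
      rw [Algebra.smul_def, mul_smul]
      rfl⟩
    let f₀ : L ⊗[A] H →ₗ[L] S :=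
      { toFun := fun x => S.ρ (mapScalars A H L C x) s
        map_add' := fun x y => by rw [map_add, map_add, LinearMap.add_apply]
        map_smul' := fun c x => by
          rw [mapScalars_smul, map_smul, LinearMap.smul_apply, algebraMap_smul, RingHom.id_apply] }
    -- The shift by `j` puts `1` in degree `j`, so that `x ↦ x s` has degree zero.
    let W : GrMod L (grBC L 𝒜) := (regular (grBC L 𝒜)).shift j
    let f : W →ₗ[L] S := f₀
    have hf := isGradedHom_liftBaseChange (W := W) (V := S) (f := f) (fun h (w : L ⊗[A] H) => by
        change S.ρ (mapScalars A H L C ((1 ⊗ₜ h) * w)) s =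
          S.ρ (1 ⊗ₜ h) (S.ρ (mapScalars A H L C w) s)
        rw [map_mul, mapScalars_tmul, map_one, ρ_mul]) (fun i w hw => by
        have := S.map_mem (mapScalars_mem C (show w ∈ grBC L 𝒜 (i - j) from hw)) hs
        rwa [sub_add_cancel] at this)
    obtain ⟨T, hT⟩ := exists_simple_extend_eq hsimp hS W _ hf (fun h => by
      refine hs0 ?_
      have h1 : f (1 : L ⊗[A] H) = s := by
        change S.ρ (mapScalars A H L C 1) s = s
        rw [map_one, ρ_one]
      have h2 : f.liftBaseChange C (1 ⊗ₜ (1 : L ⊗[A] H)) = s := (one_smul C _).trans h1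
      rw [← h2]
      exact LinearMap.congr_fun h _)
    exact ⟨clsPlus T, by rw [extendPlus, R0Plus.map_clsPlus, hT]⟩
  intro x
  obtain ⟨V, rfl⟩ := clsPlus_surjective x
  obtain ⟨l, hl, e⟩ := exists_list_simple V
  rw [← e]
  refine AddMonoidHom.mem_mrange.1 (AddSubmonoid.list_sum_mem _ fun x hx => ?_)
  obtain ⟨S, hS, rfl⟩ := List.mem_map.1 hx
  exact key S (hl S hS)

theorem proj_extend_one_tmul (V : GrMod L (grBC L 𝒜)) (i : ℤ) (v : V) :
    (V.extend C).proj i ((1 : C) ⊗ₜ[L] v) = (1 : C) ⊗ₜ[L] V.proj i v := by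
  let P : C ⊗[L] V →ₗ[C] C ⊗[L] V := (V.extend C).proj i
  have : P.restrictScalars L ∘ₗ TensorProduct.mk L C V 1 = TensorProduct.mk L C V 1 ∘ₗ V.proj i := by
    refine ext_gr fun j w hw => ?_
    have hm : (1 : C) ⊗ₜ[L] w ∈ (V.extend C).gr j := Submodule.tmul_mem_baseChange_of_mem 1 hw
    rcases eq_or_ne j i with rfl | hij
    · change (V.extend C).proj j ((1 : C) ⊗ₜ[L] w) = (1 : C) ⊗ₜ[L] V.proj j w
      rw [proj_of_mem hw]
      exact proj_of_mem hm
    · change (V.extend C).proj i ((1 : C) ⊗ₜ[L] w) = (1 : C) ⊗ₜ[L] V.proj i w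
      rw [proj_of_mem_ne hw hij, TensorProduct.tmul_zero]
      exact proj_of_mem_ne hm hij
  exact LinearMap.congr_fun this v

theorem baseChange_ρ_mem {V : GrMod L (grBC L 𝒜)} {p : Submodule C (C ⊗[L] V)}
    (hp : (V.extend C).IsGrSub p) (x : L ⊗[A] H) {z : C ⊗[L] V} (hz : z ∈ p) :
    (V.ρ x).baseChange C z ∈ p := by
  have := hp.act (mapScalars A H L C x) z hz
  rwa [show (V.extend C).ρ (mapScalars A H L C x) = (V.ρ x).baseChange C from
    extendRep_mapScalars C V.ρ x] at this

theorem nontrivial_extend (V : GrMod L (grBC L 𝒜)) [Nontrivial V] : Nontrivial (V.extend C) := by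
  refine Module.nontrivial_of_finrank_pos (R := C) ?_
  change 0 < Module.finrank C (C ⊗[L] V)
  rw [Module.finrank_baseChange]
  exact Module.finrank_pos

/-- Here `v ↦ 1 ⊗ v` is onto, so a graded submodule is determined by its preimage in `V`. -/
theorem isSimple_extend_of_bijective (hC : Function.Surjective (algebraMap L C))
    {V : GrMod L (grBC L 𝒜)} (hV : V.IsSimple) : (V.extend C).IsSimple := by
  have := hV.nontrivial
  refine ⟨nontrivial_extend V, fun (p : Submodule C (C ⊗[L] V)) hp => ?_⟩
  let q : Submodule L V := (p.restrictScalars L).comap (TensorProduct.mk L C V 1)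
  have hq : V.IsGrSub q :=
    { act := fun h v hv => baseChange_ρ_mem hp h hv
      proj := fun i v hv => by
        have h1 := hp.proj i _ hv
        exact (congrArg (· ∈ p) (proj_extend_one_tmul V i v)).mp h1 }
  have hmk : Function.Surjective (TensorProduct.mk L C V 1) := by
    intro z
    induction z with
    | zero => exact ⟨0, map_zero _⟩
    | add a b ha hb =>
      obtain ⟨v, rfl⟩ := ha
      obtain ⟨w, rfl⟩ := hb
      exact ⟨v + w, map_add _ _ _⟩
    | tmul c v =>
      obtain ⟨l, rfl⟩ := hC c
      refine ⟨l • v, ?_⟩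
      rw [TensorProduct.mk_apply, TensorProduct.tmul_smul, TensorProduct.smul_tmul',
        Algebra.smul_def, mul_one]
  rcases hV.eq_bot_or_eq_top q hq with h | h
  · left
    change p = (⊥ : Submodule C (C ⊗[L] V))
    rw [eq_bot_iff]
    intro z hz
    obtain ⟨v, rfl⟩ := hmk z
    have : v ∈ q := hz
    rw [h, Submodule.mem_bot] at this
    rw [this]
    exact (Submodule.mem_bot C).2 (map_zero _)
  · right
    change p = (⊤ : Submodule C (C ⊗[L] V))
    rw [eq_top_iff]
    intro z _
    obtain ⟨v, rfl⟩ := hmk z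
    have : v ∈ q := by rw [h]; trivial
    exact this

theorem isSimple_extend_of_surjective {V : GrMod L (grBC L 𝒜)} (hV : Nontrivial V)
    (hρ : Function.Surjective V.ρ) : (V.extend C).IsSimple := by
  refine ⟨nontrivial_extend V, fun (p : Submodule C (C ⊗[L] V)) hp => ?_⟩
  rw [or_iff_not_imp_left]
  intro hb
  obtain ⟨z, hz, hz0⟩ := (Submodule.ne_bot_iff p).1 hb
  let b := Module.Free.chooseBasis L V
  let bC := b.baseChange C
  obtain ⟨j, hj⟩ : ∃ j, bC.repr z j ≠ 0 := by
    by_contra! hc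
    exact hz0 (bC.repr.injective (Finsupp.ext fun j => by rw [hc j, map_zero, Finsupp.zero_apply]))
  have hmem : ∀ l, bC l ∈ p := by
    intro l
    -- A rank-one operator taking `z` to its nonzero `j`-th coordinate times the `l`-th basis
    -- vector; `p` therefore contains the whole basis.
    obtain ⟨x, hx⟩ := hρ ((b.coord j).smulRight (b l))
    have h1 : (V.ρ x).baseChange C = (bC.coord j).smulRight (bC l) := by
      refine bC.ext fun m => ?_
      rw [hx]
      simp [bC, Module.Basis.baseChange_apply, Finsupp.single_apply]
      split_ifs <;> simp
    have h2 := baseChange_ρ_mem hp x hz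
    rw [h1] at h2
    exact (p.smul_mem_iff hj).1 h2
  exact eq_top_iff.2 (bC.span_eq ▸ Submodule.span_le.2 (by rintro _ ⟨l, rfl⟩; exact hmem l))

end ExtendField

/-! ### Simplicity without the grading, and density for split algebras -/

section Ungraded

variable {F : Type u} [Field F] {H : Type u} [Ring H] [Algebra F H] {𝒜 : ℤ → Submodule F H}

theorem finite_gr_ne_bot (V : GrMod F 𝒜) : {i | V.gr i ≠ ⊥}.Finite :=
  WellFoundedGT.finite_ne_bot_of_iSupIndep
    ((DirectSum.isInternal_submodule_iff_iSupIndep_and_iSup_eq_top _).1 V.isInternal).1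

/-- A graded simple module is simple. -/
theorem IsSimple.eq_top_of_ne_bot [GradedAlgebra 𝒜] {V : GrMod F 𝒜} (hV : V.IsSimple)
    {W : Submodule F V} (hW : ∀ h, ∀ w ∈ W, V.ρ h w ∈ W) (h0 : W ≠ ⊥) : W = ⊤ := by
  classical
  let E : ℤ → Submodule F V := fun j => ⨆ i : Set.Iio j, V.gr i
  have hE : ∀ i j, i < j → V.gr i ≤ E j := fun i j hij =>
    le_iSup (fun i : Set.Iio j => V.gr i) ⟨i, hij⟩
  -- `q j` consists of the leading forms of degree `j`: homogeneous elements that agree with an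
  -- element of `W` up to terms of lower degree. They form a graded submodule.
  let q : ℤ → Submodule F V := fun j => (W ⊔ E j) ⊓ V.gr j
  have hq : V.IsGrSub (⨆ j, q j) := by
    refine isGrSub_iSup (fun _ => inf_le_right) ?_
    rintro a j h v hh ⟨hv, hvj⟩
    refine ⟨?_, V.map_mem hh hvj⟩
    have : W ⊔ E j ≤ (W ⊔ E (a + j)).comap (V.ρ h) := by
      refine sup_le (fun w hw => Submodule.mem_sup_left (hW h w hw)) (iSup_le ?_)
      rintro ⟨i, hi⟩ w hw
      exact Submodule.mem_sup_right
        (hE (a + i) (a + j) (add_lt_add_right (Set.mem_Iio.1 hi) a) (V.map_mem hh hw))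
    exact this hv
  rcases hV.eq_bot_or_eq_top _ hq with h | h
  · exfalso
    obtain ⟨w, hw, hw0⟩ := (Submodule.ne_bot_iff W).1 h0
    obtain ⟨s, hs⟩ := V.exists_sum_proj w
    let t := s.filter fun i => V.proj i w ≠ 0
    have ht : ∑ i ∈ t, V.proj i w = w := by
      rw [Finset.sum_filter_ne_zero, hs]
    have hne : t.Nonempty := by
      rw [Finset.nonempty_iff_ne_empty]
      intro hc
      rw [hc, Finset.sum_empty] at ht
      exact hw0 ht.symm
    have hj := t.max'_mem hne
    -- The component of top degree of a nonzero `w ∈ W` is a nonzero leading form, so the leading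
    -- forms cannot all vanish.
    set j := t.max' hne
    refine (Finset.mem_filter.1 hj).2 ?_
    have hjq : V.proj j w ∈ q j := by
      refine ⟨?_, V.proj_mem j w⟩
      rw [← Finset.add_sum_erase t _ hj] at ht
      rw [eq_sub_of_add_eq ht]
      refine sub_mem (Submodule.mem_sup_left hw) (Submodule.mem_sup_right (sum_mem fun i hi => ?_))
      exact hE i j (lt_of_le_of_ne (t.le_max' i (Finset.mem_of_mem_erase hi))
        (Finset.ne_of_mem_erase hi)) (V.proj_mem i w)
    have := Submodule.mem_iSup_of_mem j hjq
    rw [h] at this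
    exact (Submodule.mem_bot F).1 this
  -- If every homogeneous element is a leading form, then `V_j ⊆ W + ∑_{i<j} V_i`. As only finitely
  -- many components are nonzero, induction on the degree from a lower bound `m` gives `V_j ⊆ W`.
  · have hgr : ∀ j, V.gr j ≤ W ⊔ E j := fun j v hv => by
      have := proj_mem_of_mem_iSup (q := q) (fun _ => inf_le_right)
        (h.symm ▸ Submodule.mem_top : v ∈ ⨆ j, q j) j
      rw [proj_of_mem hv] at this
      exact this.1
    obtain ⟨m, hm⟩ := V.finite_gr_ne_bot.bddBelow
    have key : ∀ (n : ℕ) (i : ℤ), i < m + n → V.gr i ≤ W := by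
      intro n
      induction n with
      | zero =>
        intro i hi
        have : V.gr i = ⊥ := by
          by_contra hc
          have := hm hc
          omega
        rw [this]
        exact bot_le
      | succ n ih =>
        intro i hi
        refine (hgr i).trans (sup_le le_rfl (iSup_le ?_))
        rintro ⟨k, hk⟩
        refine ih k ?_
        have := Set.mem_Iio.1 hk
        push_cast at hi
        omega
    rw [eq_top_iff, ← V.iSup_gr]
    refine iSup_le fun i => key (i - m).toNat.succ i ?_
    have := Int.self_le_toNat (i - m)
    push_cast
    omega

/-- Jacobson density for `V` as an ungraded simple module. Splitness makes `End_H(V)` consist of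
scalars, so every `F`-linear map commutes with it; density on a finite spanning set then gives
equality. -/
theorem IsSimple.ρ_surjective [GradedAlgebra 𝒜] {V : GrMod F 𝒜} (hV : V.IsSimple)
    (hH : IsSplit F H) : Function.Surjective V.ρ := by
  let _ : Module H V := Module.compHom V V.ρ.toRingHom
  have hsm : ∀ (h : H) (v : V), h • v = V.ρ h v := fun _ _ => rfl
  have : IsScalarTower F H V := ⟨fun c h v => by
    rw [hsm, hsm, map_smul, LinearMap.smul_apply]⟩
  have := hV.nontrivial
  have : IsSimpleModule H V := by
    refine { eq_bot_or_eq_top := fun W => ?_ }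
    rw [or_iff_not_imp_left]
    intro hb
    have hb' : W.restrictScalars F ≠ ⊥ := fun h => hb (by
      rwa [Submodule.restrictScalars_eq_bot_iff] at h)
    have := hV.eq_top_of_ne_bot (W := W.restrictScalars F) (fun h w hw => W.smul_mem h hw) hb'
    rwa [Submodule.restrictScalars_eq_top_iff] at this
  intro g
  let g' : Module.End (Module.End H V) V :=
    { toFun := g
      map_add' := map_add g
      map_smul' := fun φ v => by
        obtain ⟨c, hc⟩ := hH V φ
        simp only [Module.End.smul_def, RingHom.id_apply]
        rw [hc, hc, map_smul] }
  obtain ⟨X, hX⟩ := Module.Finite.fg_top (R := F) (M := V)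
  obtain ⟨r, hr⟩ := jacobson_density g' X
  refine ⟨r, LinearMap.ext_on hX fun x hx => ?_⟩
  exact (hr x hx).symm

end Ungraded

end GrMod

/-! ## The graded decomposition map -/

section Module

variable {A H : Type u} [CommRing A] [Ring H] [Algebra A H] {𝒜 : ℤ → Submodule A H}
  {K : Type u} [Field K] [Algebra A K]

theorem polyMapBC_add (x y : R0Plus (grBC K 𝒜)) (h : 𝒜 0) (i : ℤ) :
    polyMapBC 𝒜 K (x + y) h i = polyMapBC 𝒜 K x h i * polyMapBC 𝒜 K y h i :=
  polyMap_add _ _ _ _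

theorem polyMapBC_T_smul (j : ℤ) (x : R0Plus (grBC K 𝒜)) (h : 𝒜 0) (i : ℤ) :
    polyMapBC 𝒜 K ((LaurentPolynomial.T j : ℕ[T;T⁻¹]) • x) h i = polyMapBC 𝒜 K x h (i - j) := by
  obtain ⟨V, rfl⟩ := clsPlus_surjective x
  rw [T_smul_clsPlus, polyMapBC, polyMapBC, polyMap_clsPlus, polyMap_clsPlus]
  rfl

theorem map_smul_of_map_T_smul {M N : Type*} [AddCommMonoid M] [AddCommMonoid N]
    [Module ℕ[T;T⁻¹] M] [Module ℕ[T;T⁻¹] N] (d : M →+ N)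
    (hd : ∀ (j : ℤ) (x : M), d ((LaurentPolynomial.T j : ℕ[T;T⁻¹]) • x) =
      (LaurentPolynomial.T j : ℕ[T;T⁻¹]) • d x) (c : ℕ[T;T⁻¹]) (x : M) :
    d (c • x) = c • d x := by
  induction c using LaurentPolynomial.induction_on' with
  | add p q hp hq => rw [add_smul, add_smul, map_add, hp, hq]
  | C_mul_T n a =>
    have : (LaurentPolynomial.C a : ℕ[T;T⁻¹]) = (a : ℕ[T;T⁻¹]) := map_natCast LaurentPolynomial.C a
    rw [this, mul_smul, mul_smul, Nat.cast_smul_eq_nsmul, Nat.cast_smul_eq_nsmul, map_nsmul, hd]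

end Module

namespace SpecValRing

variable {A K L H : Type u} [CommRing A] [Field K] [Algebra A K] [Ring H] [Algebra A H]
  [Field L] [Algebra A L]
  {𝒜 : ℤ → Submodule A H}

/-- The characteristic polynomial over `O` equals the image of `p`, because `O[X] → K[X]` is
injective; reducing it modulo the maximal ideal gives the claim. -/
theorem polyMapBC_residue (S : SpecValRing A K L) (V : GrMod S.O (grBC S.O 𝒜))
    [Module.Free S.O V] {p : 𝒜 0 → ℤ → Polynomial A}
    (hp : coeffMap A K p = polyMapBC 𝒜 K (clsPlus (V.extend K))) :
    polyMapBC 𝒜 S.k (clsPlus (V.extend S.k)) = coeffMap A S.k p := by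
  funext h i
  have := V.free_gr i
  have h1 := congrFun (congrFun hp h) i
  rw [polyMapBC_clsPlus_extend, coeffMap, IsScalarTower.algebraMap_eq A S.O K,
    ← Polynomial.map_map] at h1
  have h2 := Polynomial.map_injective _ (IsFractionRing.injective S.O K) h1
  rw [polyMapBC_clsPlus_extend, ← h2, Polynomial.map_map, ← IsScalarTower.algebraMap_eq]
  rfl

variable [IsFractionRing (algebraMap A L).range L]

/-- In both cases simple graded `LH`-modules stay simple over `k`: by density if `LH` is split,
trivially if `L = k`. -/
theorem extendPlus_bijective (S : SpecValRing A K L) [GradedAlgebra 𝒜] [Module.Finite A H]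
    (hS : S.SplitOrPerfect H) : Function.Bijective (extendPlus 𝒜 L S.k) := by
  refine ⟨extendPlus_injective L S.k, GrMod.extendPlus_surjective fun V hV => ?_⟩
  rcases hS with h | ⟨h, -⟩
  · exact GrMod.isSimple_extend_of_surjective hV.nontrivial (hV.ρ_surjective h)
  · exact GrMod.isSimple_extend_of_bijective h.2 hV

theorem polyMapBC_eq_of_extendPlus_eq (S : SpecValRing A K L) (V : GrMod S.O (grBC S.O 𝒜))
    [Module.Free S.O V] {p : 𝒜 0 → ℤ → Polynomial A}
    (hp : coeffMap A K p = polyMapBC 𝒜 K (clsPlus (V.extend K))) {y : R0Plus (grBC L 𝒜)}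
    (hy : extendPlus 𝒜 L S.k y = clsPlus (V.extend S.k)) :
    polyMapBC 𝒜 L y = coeffMap A L p := by
  funext h i
  apply Polynomial.map_injective _ (algebraMap L S.k).injective
  rw [← polyMapBC_extendPlus, hy, S.polyMapBC_residue V hp, coeffMap, coeffMap,
    Polynomial.map_map, ← IsScalarTower.algebraMap_eq]

/-- The right-hand side does not involve `O`, which is what makes the reduction map independent of
the valuation ring. -/
theorem isModularReduction_iff (S : SpecValRing A K L) [GradedAlgebra 𝒜] [Module.Finite A H]
    (hS : S.SplitOrPerfect H) {pA : R0Plus (grBC K 𝒜) → 𝒜 0 → ℤ → Polynomial A}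
    (hpA : ∀ x, coeffMap A K (pA x) = polyMapBC 𝒜 K x)
    {d : R0Plus (grBC K 𝒜) → R0Plus (grBC L 𝒜)} :
    S.IsModularReduction d ↔ ∀ x, polyMapBC 𝒜 L (d x) = coeffMap A L (pA x) := by
  constructor
  · intro hd x
    obtain ⟨V, rfl⟩ := clsPlus_surjective x
    obtain ⟨W, hW, e⟩ := V.exists_lattice (O := S.O)
    rw [← e]
    exact S.polyMapBC_eq_of_extendPlus_eq W (hpA _) (hd W hW)
  · intro hd V hV
    obtain ⟨y, hy⟩ := (S.extendPlus_bijective hS).2 (clsPlus (V.extend S.k))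
    rw [← hy, polyMapBC_injective (𝒜 := 𝒜) L ((hd _).trans
      (S.polyMapBC_eq_of_extendPlus_eq V (hpA _) hy).symm)]

end SpecValRing

end

end GrDec
-- The main theorem
open GrDec in
theorem theorem2 {A K L H : Type u} [CommRing A] [IsDomain A] [IsIntegrallyClosed A]
    [Field K] [Algebra A K] [IsFractionRing A K]
    [Ring H] [Algebra A H] [Module.Finite A H] [Module.Free A H]
    (𝒜 : ℤ → Submodule A H) [GradedAlgebra 𝒜]
    [Field L] [Algebra A L] [IsFractionRing (algebraMap A L).range L]
    (S : SpecValRing A K L) (hS : S.SplitOrPerfect H) :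
    (∀ x : R0Plus (grBC K 𝒜), ∃ V : GrMod S.O (grBC S.O 𝒜),
      Module.Free S.O V ∧ clsPlus (V.extend K) = x) ∧
    Function.Bijective (extendPlus 𝒜 L S.k) ∧
    ∃ d : R0Plus (grBC K 𝒜) →ₗ[ℕ[T;T⁻¹]] R0Plus (grBC L 𝒜),
      S.IsModularReduction d ∧
      (∃ pA : R0Plus (grBC K 𝒜) → 𝒜 0 → ℤ → Polynomial A,
        (∀ x, coeffMap A K (pA x) = polyMapBC 𝒜 K x) ∧
        (∀ x, polyMapBC 𝒜 L (d x) = coeffMap A L (pA x)) ∧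
        ∀ d' : R0Plus (grBC K 𝒜) → R0Plus (grBC L 𝒜),
          (∀ x, polyMapBC 𝒜 L (d' x) = coeffMap A L (pA x)) → d' = d) ∧
      ∀ S' : SpecValRing A K L, S'.SplitOrPerfect H →
        ∀ d' : R0Plus (grBC K 𝒜) → R0Plus (grBC L 𝒜), S'.IsModularReduction d' ↔ d' = d := by
  have hlat : ∀ x : R0Plus (grBC K 𝒜), ∃ V : GrMod S.O (grBC S.O 𝒜),
      Module.Free S.O V ∧ clsPlus (V.extend K) = x := by
    intro x
    obtain ⟨V, rfl⟩ := clsPlus_surjective x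
    exact V.exists_lattice
  refine ⟨hlat, S.extendPlus_bijective hS, ?_⟩
  choose pA hpA using exists_coeffMap_eq_polyMapBC (𝒜 := 𝒜) K
  have hinj := polyMapBC_injective (𝒜 := 𝒜) L
  have hpoly : ∀ (x y : R0Plus (grBC K 𝒜)) (h : 𝒜 0) (i j : ℤ),
      polyMapBC 𝒜 K y h i = polyMapBC 𝒜 K x h j → pA y h i = pA x h j := by
    intro x y h i j e
    rw [← hpA, ← hpA] at e
    exact Polynomial.map_injective _ (IsFractionRing.injective A K) e
  have hmul : ∀ x y h i, pA (x + y) h i = pA x h i * pA y h i := by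
    intro x y h i
    apply Polynomial.map_injective _ (IsFractionRing.injective A K)
    have e := polyMapBC_add (𝒜 := 𝒜) x y h i
    rw [← hpA, ← hpA, ← hpA] at e
    rw [Polynomial.map_mul]
    exact e
  -- Existence only: reduce a lattice and descend its class from `k` to `L`. The choices of lattice
  -- and of `y` do not matter, since `pA x` depends only on `x` and `𝔭_L` is injective.
  have hd : ∀ x, ∃ y : R0Plus (grBC L 𝒜), polyMapBC 𝒜 L y = coeffMap A L (pA x) := by
    intro x
    obtain ⟨V, hV, rfl⟩ := hlat x
    obtain ⟨y, hy⟩ := (S.extendPlus_bijective hS).2 (clsPlus (V.extend S.k))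
    exact ⟨y, S.polyMapBC_eq_of_extendPlus_eq V (hpA _) hy⟩
  choose d₀ hd₀ using hd
  have hadd : ∀ x y, d₀ (x + y) = d₀ x + d₀ y := by
    intro x y
    refine hinj (funext fun h => funext fun i => ?_)
    rw [polyMapBC_add, hd₀, hd₀, hd₀, coeffMap, coeffMap, coeffMap, hmul, Polynomial.map_mul]
  have hzero : d₀ 0 = 0 := by
    refine hinj (funext fun h => funext fun i => ?_)
    have e' := polyMap_zero (𝒜 := grBC L 𝒜)
      ⟨1 ⊗ₜ (h : H), Submodule.tmul_mem_baseChange_of_mem 1 h.2⟩ i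
    have e'' : pA 0 h i = 1 := by
      apply Polynomial.map_injective _ (IsFractionRing.injective A K)
      rw [Polynomial.map_one]
      exact (congrFun (congrFun (hpA 0) h) i).trans (polyMap_zero _ _)
    rw [hd₀, coeffMap, e'', Polynomial.map_one]
    exact e'.symm
  let d₁ : R0Plus (grBC K 𝒜) →+ R0Plus (grBC L 𝒜) := ⟨⟨d₀, hzero⟩, hadd⟩
  -- It suffices to treat the powers of `q`, which only translate the index of the polynomial
  -- families, on both sides alike.
  have hsmul : ∀ (c : ℕ[T;T⁻¹]) (x), d₁ (c • x) = c • d₁ x :=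
    map_smul_of_map_T_smul d₁ fun j x => by
      refine hinj (funext fun h => funext fun i => ?_)
      rw [polyMapBC_T_smul]
      change polyMapBC 𝒜 L (d₀ _) h i = polyMapBC 𝒜 L (d₀ x) h (i - j)
      rw [hd₀, hd₀, coeffMap, coeffMap, hpoly x _ h i (i - j) (polyMapBC_T_smul j x h i)]
  let d : R0Plus (grBC K 𝒜) →ₗ[ℕ[T;T⁻¹]] R0Plus (grBC L 𝒜) :=
    { toFun := d₀, map_add' := hadd, map_smul' := hsmul }
  have huniq : ∀ d' : R0Plus (grBC K 𝒜) → R0Plus (grBC L 𝒜),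
      (∀ x, polyMapBC 𝒜 L (d' x) = coeffMap A L (pA x)) → d' = d := fun d' h =>
    funext fun x => hinj ((h x).trans (hd₀ x).symm)
  refine ⟨d, (S.isModularReduction_iff hS hpA).2 hd₀, ⟨pA, hpA, hd₀, huniq⟩, fun S' hS' d' => ?_⟩
  refine ⟨fun h => huniq d' ((S'.isModularReduction_iff hS' hpA).1 h), ?_⟩
  rintro rfl
  exact (S'.isModularReduction_iff hS' hpA).2 hd₀
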